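/- **Setting.** Let $N\in\mathbb N$ and $\mathcal H=\ell^2(\mathbb Z^2)\otimes\mathbb C^N\otimes\mathbb C^2$. For an operator $A$ in $\mathcal H$ whose domain contains the canonical basis vectors $\delta_{\mathbf n}\otimes e_j\otimes\phi_s$, let $A_{\mathbf m,\mathbf n}\in\mathrm{End}(\mathbb C^N\otimes\mathbb C^2)$, $\mathbf m,\mathbf n\in\mathbb Z^2$, be its kernel. Let $H$ be a bounded self-adjoint operator on $\mathcal H$ such that * (near-sightedness) there are $C,\zeta>0$ with $|H_{\mathbf m,\mathbf n}|\le C\,e^{-\frac1\zeta\|\mathbf m-\mathbf n\|_1}$ for all $\mathbf m,\mathbf n\in\mathbb Z^2$; * (periodicity) $H_{\mathbf m,\mathbf n}=H_{\mathbf m-\mathbf p,\mathbf n-\mathbf p}$ for all $\mathbf m,\mathbf n,\mathbf p\in\mathbb Z^2$; * (gap) there are non-empty $I_1,I_2\subseteq\mathbb R$ and $a,b\in\mathbb R$ with $\mathrm{Spectrum}(H)=I_1\cup I_2$ and $\sup I_1<a<b<\inf I_2$. Let $\mu\in(a,b)$ and let $P=\chi_{(-\infty,\mu)}(H)$ be the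 Fermi projection. Let $(X_j\varphi)_{\mathbf n}=n_j\varphi_{\mathbf n}$ ($j=1,2$) be the position operators on their maximal domains and $S_z=\mathrm{Id}\otimes\mathrm{Id}\otimes\frac12 s_z$ with $s_z=\mathrm{diag}(1,-1)$. Sums, products and commutators of operators are taken on their natural domains. A *switch function in direction $j$* is a function $\Lambda:\mathbb Z^2\to[0,1]$ that depends only on $n_j$ and for which there are $n_-<n_+$ with $\Lambda=0$ if $n_j<n_-$ and $\Lambda=1$ if $n_j\ge n_+$; it is identified with the corresponding multiplication operator. For odd $L$ let $\chi_L$ and $\chi_{j,L}$ be (multiplication by) the characteristic functions of $\{\mathbf n:\|\mathbf n\|_\infty\le L/2\}$ and of $\{\mathbf n:|n_j|\le L/2\}$. Put $$\tau(A):=\lim_{L\to\infty,\ L\ \mathrm{odd}}\frac1{L^2}\mathrm{Tr}(\chi_LA\chi_L),\qquad 1\text{-}\mathrm{p.v.Tr}(A):=\lim_{L\to\infty,\ L\ \mathrm{odd}}\mathrm{Tr}(\chi_{1,L}A\chi_{1,L}),$$ which are said to be well-defined (finite) if the operators under the trace are trace class for every odd $L$ and the limit exists in $\mathbb C$. Finally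 set $$\Sigma_K^{s_z}:=iP\big[[P,X_1S_z],[P,X_2]\big]P,\qquad \mathcal T_{s_z}:=iP\big[[P,S_z],[P,X_2]\big]P,$$ $$G_K^{s_z}(\Lambda_1,\Lambda_2):=1\text{-}\mathrm{p.v.Tr}\Big(iP\big[[P,\Lambda_1S_z],[P,\Lambda_2]\big]P\Big)$$ for switch functions $\Lambda_1,\Lambda_2$ in directions $1$ and $2$. **Theorem.** 1. Let $\Lambda_2$ be a switch function in direction $2$. If $G_K^{s_z}(\Lambda_1,\Lambda_2)$ is finite for at least one switch function $\Lambda_1$ in direction $1$, then $G_K^{s_z}(\Lambda_1',\Lambda_2)$ is finite for every switch function $\Lambda_1'$ in direction $1$, and it does not depend on $\Lambda_1'$. 2. The domains of $\Sigma_K^{s_z}$ and $\mathcal T_{s_z}$ contain all the canonical basis vectors, and $$(\Sigma_K^{s_z})_{\mathbf m,\mathbf n}=(\Sigma_K^{s_z})_{\mathbf m-\mathbf p,\mathbf n-\mathbf p}+p_1\,(\mathcal T_{s_z})_{\mathbf m-\mathbf p,\mathbf n-\mathbf p}\qquad\text{for all }\mathbf m,\mathbf n,\mathbf p\in\mathbb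 Z^2.$$ Moreover $\sigma_K^{s_z}:=\tau(\Sigma_K^{s_z})$ is well-defined, and $\sigma_K^{s_z}=\mathrm{Tr}(\chi_1\Sigma_K^{s_z}\chi_1)$. 3. For all switch functions $\Lambda_1,\Lambda_2$ in directions $1$ and $2$, $G_K^{s_z}(\Lambda_1,\Lambda_2)$ is finite and $\sigma_K^{s_z}=G_K^{s_z}(\Lambda_1,\Lambda_2)$. In particular $G_K^{s_z}$ is independent of both switch functions. -/

import Mathlib

open scoped ComplexOrder

noncomputable section

namespace SpinTransport

/-! ### The Hilbert space `ℓ²(ℤ²) ⊗ ℂ^N ⊗ ℂ²` -/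

/-- The lattice `ℤ²`; the coordinate `n 0` is the first one, `n 1` the second one. -/
abbrev Lattice : Type := Fin 2 → ℤ

/-- Internal degrees of freedom: a point of the unit cell and a spin (`0` is up, `1` is down). -/
abbrev Internal (N : ℕ) : Type := Fin N × Fin 2

/-- Labels of the canonical orthonormal basis `δ_n ⊗ e_j ⊗ φ_s`. -/
abbrev Site (N : ℕ) : Type := Lattice × Internal N

/-- `ℓ²(ℤ²) ⊗ ℂ^N ⊗ ℂ²`, realised as the space of square-summable families on
`ℤ² × {1, …, N} × {↑, ↓}`. -/
abbrev Hdisc (N : ℕ) : Type := lp (fun _ : Site N => ℂ) 2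

/-- The canonical orthonormal basis vector `δ_n ⊗ e_j ⊗ φ_s`. -/
def delta {N : ℕ} (x : Site N) : Hdisc N := lp.single 2 x (1 : ℂ)

/-! ### Operators: linear maps defined on a subspace, with the natural domains -/

/-- An everywhere defined bounded operator. -/
def ofBounded {N : ℕ} (A : Hdisc N →L[ℂ] Hdisc N) : Hdisc N →ₗ.[ℂ] Hdisc N :=
  (A : Hdisc N →ₗ[ℂ] Hdisc N).toPMap ⊤

/-- The product `B A` on its natural domain `{φ ∈ D(A) | A φ ∈ D(B)}`. -/
def prod {N : ℕ} (B A : Hdisc N →ₗ.[ℂ] Hdisc N) : Hdisc N →ₗ.[ℂ] Hdisc N where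
  domain := (B.domain.comap A.toFun).map A.domain.subtype
  toFun :=
    { toFun := fun φ => B ⟨A ⟨φ.1, by
          obtain ⟨y, -, hy⟩ := φ.2
          exact hy ▸ y.2⟩, by
          obtain ⟨φ, y, h, rfl⟩ := φ
          exact h⟩
      map_add' := fun φ ψ => by
        rw [← LinearPMap.map_add]
        congr 1
        apply Subtype.ext
        exact LinearPMap.map_add A ⟨φ.1, _⟩ ⟨ψ.1, _⟩
      map_smul' := fun c φ => by
        rw [RingHom.id_apply, ← LinearPMap.map_smul]
        congr 1
        apply Subtype.ext
        exact LinearPMap.map_smul A c ⟨φ.1, _⟩ }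

/-- The commutator `[A, B] = A B - B A` on its natural domain `D(A B) ∩ D(B A)`. -/
def comm {N : ℕ} (A B : Hdisc N →ₗ.[ℂ] Hdisc N) : Hdisc N →ₗ.[ℂ] Hdisc N :=
  prod A B - prod B A

/-- Multiplication by a function of the site, on its maximal domain
`{φ | f φ is square-summable}`. -/
def mulOp {N : ℕ} (f : Site N → ℝ) : Hdisc N →ₗ.[ℂ] Hdisc N where
  domain :=
    { carrier := {φ | Memℓp (fun x => (f x : ℂ) * φ x) 2}
      add_mem' := fun {φ ψ} hφ hψ => by
        have h := Memℓp.add hφ hψ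
        refine (congrArg (fun g => Memℓp g 2) (funext fun x => ?_)).mp h
        exact (mul_add _ _ _).symm
      zero_mem' := by
        refine (congrArg (fun g => Memℓp g 2) (funext fun x => ?_)).mp
          (zero_memℓp (E := fun _ : Site N => ℂ))
        simp
      smul_mem' := fun c φ hφ => by
        have h := Memℓp.const_smul hφ c
        refine (congrArg (fun g => Memℓp g 2) (funext fun x => ?_)).mp h
        simp [mul_left_comm] }
  toFun :=
    { toFun := fun φ => ⟨fun x => (f x : ℂ) * φ.1 x, φ.2⟩
      map_add' := fun φ ψ => by
        apply Subtype.ext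
        funext x
        exact mul_add _ _ _
      map_smul' := fun c φ => by
        apply Subtype.ext
        funext x
        simp [mul_left_comm] }

/-- Multiplication by a function of the lattice point, acting as the identity on `ℂ^N ⊗ ℂ²`. -/
def latOp (N : ℕ) (f : Lattice → ℝ) : Hdisc N →ₗ.[ℂ] Hdisc N := mulOp fun x => f x.1

/-- The position operator `X_j`. -/
def X (N : ℕ) (j : Fin 2) : Hdisc N →ₗ.[ℂ] Hdisc N := latOp N fun n => (n j : ℝ)

/-- The spin operator `S_z = 1 ⊗ 1 ⊗ s_z / 2`, where `s_z = diag (1, -1)`. -/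
def Sz (N : ℕ) : Hdisc N →ₗ.[ℂ] Hdisc N := mulOp fun x => if x.2.2 = 0 then 1 / 2 else -(1 / 2)

/-! ### Kernels, near-sightedness, periodicity, spectral gap -/

open Classical in
/-- The matrix `A_{m,n}` with entries `⟨δ_m ⊗ e_j ⊗ φ_s, A (δ_n ⊗ e_k ⊗ φ_r)⟩`; meaningful when
the basis vectors belong to the domain of `A`. -/
def kernel {N : ℕ} (A : Hdisc N →ₗ.[ℂ] Hdisc N) (m n : Lattice) :
    Matrix (Internal N) (Internal N) ℂ :=
  Matrix.of fun i k =>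
    if h : delta (n, k) ∈ A.domain then inner ℂ (delta (m, i)) (A ⟨delta (n, k), h⟩) else 0

/-- `|A_{m,n}| ≤ C exp (-‖m - n‖₁ / ζ)`, with the operator norm of the matrix `A_{m,n}`. -/
def IsNearSighted {N : ℕ} (A : Hdisc N →L[ℂ] Hdisc N) : Prop :=
  ∃ C ζ : ℝ, 0 < C ∧ 0 < ζ ∧ ∀ m n : Lattice,
    ‖Matrix.toEuclideanCLM (𝕜 := ℂ) (kernel (ofBounded A) m n)‖ ≤
      C * Real.exp (-(1 / ζ) * ∑ j, |((m j : ℝ) - n j)|)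

/-- `A_{m,n} = A_{m-p,n-p}`. -/
def IsPeriodic {N : ℕ} (A : Hdisc N →L[ℂ] Hdisc N) : Prop :=
  ∀ m n p : Lattice, kernel (ofBounded A) m n = kernel (ofBounded A) (m - p) (n - p)

/-- The interval `(a, b)` is a spectral gap of `A`: its spectrum is a union of two non-empty sets
of reals, one below `a`, the other above `b`. -/
def HasSpectralGap {N : ℕ} (A : Hdisc N →L[ℂ] Hdisc N) (a b : ℝ) : Prop :=
  ∃ I₁ I₂ : Set ℝ, I₁.Nonempty ∧ I₂.Nonempty ∧
    spectrum ℂ A = (fun r : ℝ => (r : ℂ)) '' (I₁ ∪ I₂) ∧ sSup I₁ < a ∧ a < b ∧ b < sInf I₂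

/-- The spectral projection `χ_{(-∞, μ)}(H)` of a bounded self-adjoint operator `H` on a Hilbert
space, for `μ` outside the spectrum of `H`: the characteristic function is then continuous on the
spectrum, so that the continuous functional calculus applies. -/
def spectralProjBelow {E : Type*} [NormedAddCommGroup E] [InnerProductSpace ℂ E] [CompleteSpace E]
    (H : E →L[ℂ] E) (μ : ℝ) : E →L[ℂ] E :=
  cfc ((Set.Iio μ).indicator fun _ => (1 : ℝ)) H

/-- The absolute value `|A| = (A* A)^{1/2}` of a bounded operator on a Hilbert space. -/
def absOp {E : Type*} [NormedAddCommGroup E] [InnerProductSpace ℂ E] [CompleteSpace E]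
    (A : E →L[ℂ] E) : E →L[ℂ] E :=
  CFC.abs A

/-- The Fermi projection `χ_{(-∞, μ)}(H)`, for `μ` in a spectral gap. -/
def fermi {N : ℕ} (H : Hdisc N →L[ℂ] Hdisc N) (μ : ℝ) : Hdisc N →L[ℂ] Hdisc N :=
  spectralProjBelow H μ

/-! ### Trace, directional principal value trace, trace per unit volume -/

/-- A bounded operator is trace class if `Tr |A| < ∞` (the trace of the positive operator
`|A|` may be computed in any orthonormal basis). -/
def IsTraceClass {N : ℕ} (A : Hdisc N →L[ℂ] Hdisc N) : Prop :=
  Summable fun x : Site N => (inner ℂ (delta x) (absOp A (delta x))).re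

/-- `A` is an everywhere defined bounded operator, it is trace class and its trace is `t`. -/
def HasTrace {N : ℕ} (A : Hdisc N →ₗ.[ℂ] Hdisc N) (t : ℂ) : Prop :=
  ∃ B : Hdisc N →L[ℂ] Hdisc N, A = ofBounded B ∧ IsTraceClass B ∧
    HasSum (fun x : Site N => inner ℂ (delta x) (B (delta x))) t

/-- The characteristic function `χ_L` of the square `{n | ‖n‖_∞ ≤ L / 2}`. -/
def chi (N L : ℕ) : Hdisc N →ₗ.[ℂ] Hdisc N :=
  latOp N ({n : Lattice | ∀ j, |(n j : ℝ)| ≤ (L : ℝ) / 2}.indicator fun _ => 1)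

/-- The characteristic function `χ_{j,L}` of the stripe `{n | |n_j| ≤ L / 2}`. -/
def chiDir (N : ℕ) (j : Fin 2) (L : ℕ) : Hdisc N →ₗ.[ℂ] Hdisc N :=
  latOp N ({n : Lattice | |(n j : ℝ)| ≤ (L : ℝ) / 2}.indicator fun _ => 1)

/-- The `j`-directional principal value trace of `A` exists (as a finite limit over odd `L`) and
is equal to `g`. -/
def HasDirPVTrace {N : ℕ} (j : Fin 2) (A : Hdisc N →ₗ.[ℂ] Hdisc N) (g : ℂ) : Prop :=
  ∃ t : ℕ → ℂ,
    (∀ k, HasTrace (prod (chiDir N j (2 * k + 1)) (prod A (chiDir N j (2 * k + 1)))) (t k)) ∧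
    Filter.Tendsto t Filter.atTop (nhds g)

/-- The trace per unit volume of `A` exists (as a finite limit over odd `L`) and is equal
to `s`. -/
def HasTUV {N : ℕ} (A : Hdisc N →ₗ.[ℂ] Hdisc N) (s : ℂ) : Prop :=
  ∃ t : ℕ → ℂ,
    (∀ k, HasTrace (prod (chi N (2 * k + 1)) (prod A (chi N (2 * k + 1)))) (t k)) ∧
    Filter.Tendsto (fun k : ℕ => 1 / ((2 * k + 1 : ℕ) : ℂ) ^ 2 * t k) Filter.atTop (nhds s)

/-! ### Switch functions and the Kubo-like operators -/

/-- A switch function in direction `j`. -/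
def IsSwitch (j : Fin 2) (Λ : Lattice → ℝ) : Prop :=
  (∀ n, Λ n ∈ Set.Icc (0 : ℝ) 1) ∧ (∀ m n : Lattice, m j = n j → Λ m = Λ n) ∧
    ∃ a b : ℤ, a < b ∧ (∀ n : Lattice, n j < a → Λ n = 0) ∧ ∀ n : Lattice, b ≤ n j → Λ n = 1

/-- `i P [[P, A], [P, B]] P` on its natural domain. -/
def kubo {N : ℕ} (P : Hdisc N →L[ℂ] Hdisc N) (A B : Hdisc N →ₗ.[ℂ] Hdisc N) :
    Hdisc N →ₗ.[ℂ] Hdisc N :=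
  Complex.I • prod (ofBounded P)
    (prod (comm (comm (ofBounded P) A) (comm (ofBounded P) B)) (ofBounded P))

/-- `i P [[P, Λ₁ S_z], [P, Λ₂]] P`, whose 1-directional principal value trace is the Kubo-like
spin conductance. -/
def conductanceOp {N : ℕ} (P : Hdisc N →L[ℂ] Hdisc N) (Λ₁ Λ₂ : Lattice → ℝ) :
    Hdisc N →ₗ.[ℂ] Hdisc N :=
  kubo P (prod (latOp N Λ₁) (Sz N)) (latOp N Λ₂)

/-- `Σ = i P [[P, X₁ S_z], [P, X₂]] P`, whose trace per unit volume is the Kubo-like spin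
conductivity. -/
def conductivityOp {N : ℕ} (P : Hdisc N →L[ℂ] Hdisc N) : Hdisc N →ₗ.[ℂ] Hdisc N :=
  kubo P (prod (X N 0) (Sz N)) (X N 1)

/-- The spin torque-response `𝒯 = i P [[P, S_z], [P, X₂]] P`. -/
def torqueOp {N : ℕ} (P : Hdisc N →L[ℂ] Hdisc N) : Hdisc N →ₗ.[ℂ] Hdisc N :=
  kubo P (Sz N) (X N 1)

end SpinTransport

end

/-! # Kubo-like terms of the spin conductance and of the spin conductivity -/

noncomputable section

namespace SpinTransport

open scoped ENNReal

/-! ### Matrix entries in the canonical basis. -/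

variable {N : ℕ}

/-! The Fermi projection `P` is periodic and its kernel `p` decays exponentially. Indeed the
characteristic function of `(-∞, μ)` is `(1 - sgn)/2` up to a shift and a rescaling, and on a gapped
spectrum `sgn y = y (1 - (1 - y²))^(-1/2)` is given by a geometrically convergent binomial series.
Truncating at order `n` costs `a ^ n` in operator norm, while exponentially weighted column norms of
the truncations grow at most like `F ^ n`; taking `n` proportional to the distance of two sites
balances both (`exp_decay_of_geometric`, `isLocalProj_fermi`).

As `P² = P` and multiplication operators commute, `i P [[P,f],[P,g]] P = i (P f P g P - P g P f P)`,
with kernel `i ∑ p(x,u) p(u,v) p(v,y) (f(u) g(v) - g(u) f(v))`. A constant added to `g` contributes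
`P f P - P f P = 0`. A constant `c` added to the position or switch factor of `f` contributes `c`
times the torque kernel. Translating the positions thus gives the twisted periodicity. The torque
has zero trace per cell (`cellTrace_torque`): cyclicity moves the spin to the base point of the
closed path, and what is left is a diagonal entry of `P X P - P X P`. Hence every cell contributes
equally to the trace of `Σ`.

For switch functions, the diagonal at the cell `n` is moved back to the origin. Dropping constants
as above, it becomes the cell trace built from `l(x₀ + n₀) - l(n₀)` and `l'(x₁ + n₁) - l'(n₁)`. The
identity `∑ₙ (l(v + n) - l(n)) = v` (`IsStep.hasSum_sub`) turns the sums over `n₁` and `n₀` into the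
coordinates themselves, which is the conductivity per cell, whatever the switches. The stripe traces
exist because the columns of the operator decay away from the region where `l'` varies. Statement
(1) then follows from (3) and uniqueness of limits. -/

/-- The matrix entry `⟨δ_x, A δ_y⟩`. -/
def ent (A : Hdisc N →L[ℂ] Hdisc N) (x y : Site N) : ℂ := inner ℂ (delta x) (A (delta y))

theorem inner_delta (x : Site N) (φ : Hdisc N) : inner ℂ (delta x) φ = φ x := by
  classical
  have h := lp.inner_single_left (𝕜 := ℂ) x (1 : ℂ) φ
  simpa [delta] using h

theorem ent_eq (A : Hdisc N →L[ℂ] Hdisc N) (x y : Site N) : ent A x y = A (delta y) x :=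
  inner_delta x _

theorem delta_apply (x y : Site N) : (delta x : Hdisc N) y = if y = x then 1 else 0 := by
  classical
  rw [delta, lp.single_apply]
  by_cases h : y = x
  · subst h; simp
  · simp [h]

theorem norm_delta (x : Site N) : ‖(delta x : Hdisc N)‖ = 1 := by
  classical
  rw [delta, lp.norm_single (by norm_num)]
  simp

theorem hasSum_delta (φ : Hdisc N) : HasSum (fun x => φ x • (delta x : Hdisc N)) φ := by
  classical
  have h := lp.hasSum_single (E := fun _ : Site N => ℂ) (p := 2) (by norm_num) φ
  refine h.congr_fun fun x => ?_
  rw [delta, ← lp.single_smul]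
  simp

theorem hasSum_apply (A : Hdisc N →L[ℂ] Hdisc N) (φ : Hdisc N) (x : Site N) :
    HasSum (fun y => ent A x y * φ y) (A φ x) := by
  have h := (hasSum_delta φ).mapL ((innerSL ℂ (delta x)).comp A)
  simp only [ContinuousLinearMap.comp_apply, innerSL_apply_apply, inner_delta, map_smul,
    smul_eq_mul] at h
  refine h.congr_fun fun y => ?_
  rw [ent_eq, mul_comm]

theorem apply_eq_tsum (A : Hdisc N →L[ℂ] Hdisc N) (φ : Hdisc N) (x : Site N) :
    A φ x = ∑' y, ent A x y * φ y := (hasSum_apply A φ x).tsum_eq.symm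

theorem ent_mul (A B : Hdisc N →L[ℂ] Hdisc N) (x y : Site N) :
    ent (A * B) x y = ∑' u, ent A x u * ent B u y := by
  rw [ent_eq, mul_apply_eq_comp, apply_eq_tsum]
  simp only [ent_eq]

theorem ent_add (A B : Hdisc N →L[ℂ] Hdisc N) (x y : Site N) :
    ent (A + B) x y = ent A x y + ent B x y := by
  simp [ent]

theorem ent_sub (A B : Hdisc N →L[ℂ] Hdisc N) (x y : Site N) :
    ent (A - B) x y = ent A x y - ent B x y := by
  simp [ent]

theorem ent_smul (c : ℂ) (A : Hdisc N →L[ℂ] Hdisc N) (x y : Site N) :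
    ent (c • A) x y = c * ent A x y := by
  simp [ent]

theorem ent_real_smul (c : ℝ) (A : Hdisc N →L[ℂ] Hdisc N) (x y : Site N) :
    ent (c • A) x y = c * ent A x y := by
  rw [← ent_smul]; rfl

theorem ent_one (x y : Site N) : ent (1 : Hdisc N →L[ℂ] Hdisc N) x y = if x = y then 1 else 0 := by
  rw [ent_eq, one_apply_eq_self, delta_apply]

theorem norm_ent_le (A : Hdisc N →L[ℂ] Hdisc N) (x y : Site N) : ‖ent A x y‖ ≤ ‖A‖ := by
  refine (norm_inner_le_norm _ _).trans ?_
  rw [norm_delta, one_mul]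
  simpa [norm_delta] using A.le_opNorm (delta y)

theorem norm_le_tsum_enorm (φ : Hdisc N) : ‖φ‖ₑ ≤ ∑' x, ‖φ x‖ₑ := by
  rw [← (hasSum_delta φ).tsum_eq]
  refine enorm_tsum_le_tsum_enorm.trans ?_
  refine ENNReal.tsum_le_tsum fun x => ?_
  rw [enorm_smul, (hasSum_delta φ).tsum_eq]
  simp [← ofReal_norm, norm_delta]

theorem summable_of_tsum_enorm_ne_top {ι E : Type*} [NormedAddCommGroup E] [CompleteSpace E]
    {f : ι → E} (h : ∑' i, ‖f i‖ₑ ≠ ∞) : Summable f := by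
  refine Summable.of_norm ?_
  have := ENNReal.summable_toReal h
  simpa using this

/-! ### Graphs of operators -/

/-- Membership in a graph carries both the domain condition and the value, so that compositions of
unbounded operators are handled without explicit domain proofs. -/
theorem prod_graph {A B : Hdisc N →ₗ.[ℂ] Hdisc N} {φ ψ χ : Hdisc N} (h : (φ, ψ) ∈ A.graph)
    (h' : (ψ, χ) ∈ B.graph) : (φ, χ) ∈ (prod B A).graph := by
  rw [LinearPMap.mem_graph_iff] at h h' ⊢
  obtain ⟨y, rfl, hy⟩ := h
  obtain ⟨z, hz, rfl⟩ := h'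
  simp only at hy hz
  have hz' : A y ∈ B.domain := by rw [hy, ← hz]; exact z.2
  refine ⟨⟨y, y, hz', rfl⟩, rfl, ?_⟩
  change B ⟨A ⟨y, _⟩, _⟩ = B z
  congr 1
  apply Subtype.ext
  exact hy.trans hz.symm

theorem sub_graph {A B : Hdisc N →ₗ.[ℂ] Hdisc N} {φ ψ χ : Hdisc N} (h : (φ, ψ) ∈ A.graph)
    (h' : (φ, χ) ∈ B.graph) : (φ, ψ - χ) ∈ (A - B).graph := by
  rw [LinearPMap.mem_graph_iff] at h h' ⊢
  obtain ⟨y, rfl, rfl⟩ := h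
  obtain ⟨z, hz, rfl⟩ := h'
  refine ⟨⟨y, y.2, ?_⟩, rfl, ?_⟩
  · simp only at hz
    rw [← hz]; exact z.2
  · rw [LinearPMap.sub_apply]
    congr 2
    exact Subtype.ext hz.symm

theorem comm_graph {A B : Hdisc N →ₗ.[ℂ] Hdisc N} {φ ψ χ ψ' χ' : Hdisc N}
    (hB : (φ, ψ) ∈ B.graph) (hAB : (ψ, χ) ∈ A.graph) (hA : (φ, ψ') ∈ A.graph)
    (hBA : (ψ', χ') ∈ B.graph) : (φ, χ - χ') ∈ (comm A B).graph :=
  sub_graph (prod_graph hB hAB) (prod_graph hA hBA)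

theorem smul_mem_graph {A : Hdisc N →ₗ.[ℂ] Hdisc N} {φ ψ : Hdisc N} (c : ℂ)
    (h : (φ, ψ) ∈ A.graph) : (φ, c • ψ) ∈ (c • A).graph := by
  rw [LinearPMap.mem_graph_iff] at h ⊢
  obtain ⟨y, rfl, rfl⟩ := h
  exact ⟨y, rfl, rfl⟩

theorem ofBounded_graph (A : Hdisc N →L[ℂ] Hdisc N) (φ : Hdisc N) :
    (φ, A φ) ∈ (ofBounded A).graph := by
  rw [LinearPMap.mem_graph_iff]
  exact ⟨⟨φ, trivial⟩, rfl, rfl⟩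

theorem mem_mulOp_graph {f : Site N → ℝ} {φ ψ : Hdisc N} :
    (φ, ψ) ∈ (mulOp f).graph ↔ ∀ x, ψ x = f x * φ x := by
  rw [LinearPMap.mem_graph_iff]
  constructor
  · rintro ⟨y, rfl, h⟩ x
    simp only at h
    rw [← h]; rfl
  · intro h
    have h' : (fun x => (f x : ℂ) * φ x) = ψ := funext fun x => (h x).symm
    refine ⟨⟨φ, ?_⟩, rfl, ?_⟩
    · change Memℓp (fun x => (f x : ℂ) * φ x) 2
      rw [h']; exact lp.memℓp ψ
    · exact Subtype.ext h'

theorem eq_ofBounded {A : Hdisc N →ₗ.[ℂ] Hdisc N} {B : Hdisc N →L[ℂ] Hdisc N}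
    (h : ∀ φ, (φ, B φ) ∈ A.graph) : A = ofBounded B := by
  refine (LinearPMap.eq_of_le_of_domain_eq (f := ofBounded B) ?_ ?_).symm
  · refine LinearPMap.le_of_le_graph ?_
    rintro ⟨φ, ψ⟩ hφ
    rw [LinearPMap.mem_graph_iff] at hφ
    obtain ⟨y, rfl, rfl⟩ := hφ
    exact h y
  · refine le_antisymm (fun φ _ => LinearPMap.mem_domain_of_mem_graph (h φ)) (fun φ _ => trivial)

theorem kernel_apply_of_graph {A : Hdisc N →ₗ.[ℂ] Hdisc N} {m n : Lattice} {i k : Internal N}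
    {ψ : Hdisc N} (h : (delta (n, k), ψ) ∈ A.graph) : kernel A m n i k = ψ (m, i) := by
  rw [kernel, Matrix.of_apply, dif_pos (LinearPMap.mem_domain_of_mem_graph h), inner_delta]
  rw [LinearPMap.mem_graph_iff] at h
  obtain ⟨y, hy, rfl⟩ := h
  simp only at hy
  exact congrArg (fun z => (A z : Hdisc N) (m, i)) (Subtype.ext hy.symm)

theorem kernel_ofBounded (A : Hdisc N →L[ℂ] Hdisc N) (m n : Lattice) (i k : Internal N) :
    kernel (ofBounded A) m n i k = ent A (m, i) (n, k) := by
  rw [kernel_apply_of_graph (ofBounded_graph A _), ent_eq]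

/-- If `P` is idempotent and `A`, `B` commute on `P φ`, then
`i P [[P, A], [P, B]] P φ = i (P A P B P φ - P B P A P φ)`. -/
theorem kubo_graph {P : Hdisc N →L[ℂ] Hdisc N} (hP : P * P = P) {A B : Hdisc N →ₗ.[ℂ] Hdisc N}
    {φ a b ab apb bpa : Hdisc N} (ha : (P φ, a) ∈ A.graph) (hb : (P φ, b) ∈ B.graph)
    (hapb : (P b, apb) ∈ A.graph) (hbpa : (P a, bpa) ∈ B.graph) (hab : (b, ab) ∈ A.graph)
    (hba : (a, ab) ∈ B.graph) :
    (φ, Complex.I • (P apb - P bpa)) ∈ (kubo P A B).graph := by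
  have hPP : ∀ ψ, P (P ψ) = P ψ := fun ψ => by
    rw [← mul_apply_eq_comp, hP]
  have key : ∀ {A B : Hdisc N →ₗ.[ℂ] Hdisc N} {b ab apb : Hdisc N}, (P φ, b) ∈ B.graph →
      (P b, apb) ∈ A.graph → (b, ab) ∈ A.graph →
      (P φ, P (apb - ab)) ∈ (prod (comm (ofBounded P) A) (comm (ofBounded P) B)).graph := by
    intro A B b ab apb hb hapb hab
    have h1 : (P φ, P b - b) ∈ (comm (ofBounded P) B).graph := by
      refine comm_graph hb (ofBounded_graph P b) (ofBounded_graph P _) ?_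
      rwa [hPP]
    -- `P` annihilates `P b - b`, so the half of the commutator in which `P` acts first vanishes.
    have h2 : (P b - b, P (apb - ab) - 0) ∈ (comm (ofBounded P) A).graph := by
      refine comm_graph (A.graph.sub_mem hapb hab) (ofBounded_graph P _)
        (ofBounded_graph P _) ?_
      rw [map_sub, hPP, sub_self]
      exact A.graph.zero_mem
    rw [sub_zero] at h2
    exact prod_graph h1 h2
  have h := sub_graph (key hb hapb hab) (key ha hbpa hba)
  have h' := smul_mem_graph Complex.I (prod_graph (prod_graph (ofBounded_graph P φ) h)
    (ofBounded_graph P _))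
  -- Commutation of `A` and `B` on `P φ` enters here: the same vector `ab` occurs in both terms and
  -- cancels.
  have e : P (P (apb - ab) - P (bpa - ab)) = P apb - P bpa := by
    simp only [map_sub, hPP]
    abel
  rwa [e] at h'

/-! ### Trace class operators -/

/-- Both squared norms are the quadratic form of `|A|² = A* A`. -/
theorem norm_absOp_apply {E : Type*} [NormedAddCommGroup E] [InnerProductSpace ℂ E]
    [CompleteSpace E] (A : E →L[ℂ] E) (φ : E) : ‖absOp A φ‖ = ‖A φ‖ := by
  have h1 : IsSelfAdjoint (absOp A) := (CFC.abs_nonneg A).isSelfAdjoint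
  have h2 : absOp A * absOp A = star A * A := CFC.abs_mul_abs A
  have h3 : inner ℂ (absOp A φ) (absOp A φ) = (inner ℂ (A φ) (A φ) : ℂ) := by
    rw [← ContinuousLinearMap.adjoint_inner_right, ← ContinuousLinearMap.adjoint_inner_right,
      ← ContinuousLinearMap.star_eq_adjoint, ← ContinuousLinearMap.star_eq_adjoint,
      h1.star_eq, ← mul_apply_eq_comp, h2]
    rfl
  rw [inner_self_eq_norm_sq_to_K, inner_self_eq_norm_sq_to_K] at h3
  have h4 : ‖absOp A φ‖ ^ 2 = ‖A φ‖ ^ 2 := by exact_mod_cast h3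
  exact (sq_eq_sq₀ (norm_nonneg _) (norm_nonneg _)).1 h4

/-- By Cauchy–Schwarz, `⟨δ, |A| δ⟩ ≤ ‖|A| δ‖ = ‖A δ‖`. Summable column norms are stronger than trace
class, but available for local operators. -/
theorem isTraceClass_of_summable {A : Hdisc N →L[ℂ] Hdisc N}
    (h : Summable fun x : Site N => ‖A (delta x)‖) : IsTraceClass A := by
  refine Summable.of_norm_bounded h fun x => ?_
  calc ‖(inner ℂ (delta x) (absOp A (delta x))).re‖
      ≤ ‖inner ℂ (delta x) (absOp A (delta x))‖ := Complex.abs_re_le_norm _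
    _ ≤ ‖(delta x : Hdisc N)‖ * ‖absOp A (delta x)‖ := norm_inner_le_norm _ _
    _ = ‖A (delta x)‖ := by rw [norm_delta, one_mul, norm_absOp_apply]

theorem hasTrace_of_summable {A : Hdisc N →ₗ.[ℂ] Hdisc N} {B : Hdisc N →L[ℂ] Hdisc N}
    (hAB : ∀ φ, (φ, B φ) ∈ A.graph) (h : Summable fun x : Site N => ‖B (delta x)‖) :
    HasTrace A (∑' x, ent B x x) := by
  refine ⟨B, eq_ofBounded hAB, isTraceClass_of_summable h, Summable.hasSum ?_⟩
  refine Summable.of_norm_bounded h fun x => ?_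
  simpa [norm_delta] using norm_inner_le_norm (𝕜 := ℂ) (delta x) (B (delta x))

theorem HasTrace.unique {A : Hdisc N →ₗ.[ℂ] Hdisc N} {s t : ℂ} (hs : HasTrace A s)
    (ht : HasTrace A t) : s = t := by
  obtain ⟨B, hB, -, h⟩ := hs
  obtain ⟨B', hB', -, h'⟩ := ht
  have e : B = B' := by
    ext1 φ
    have h1 := ofBounded_graph B φ
    rw [← hB, hB'] at h1
    exact LinearPMap.mem_graph_snd_inj _ h1 (ofBounded_graph B' φ) rfl
  subst e
  exact h.unique h'

theorem HasDirPVTrace.unique {j : Fin 2} {A : Hdisc N →ₗ.[ℂ] Hdisc N} {s t : ℂ}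
    (hs : HasDirPVTrace j A s) (ht : HasDirPVTrace j A t) : s = t := by
  obtain ⟨f, hf, h⟩ := hs
  obtain ⟨f', hf', h'⟩ := ht
  have e : f = f' := funext fun k => (hf k).unique (hf' k)
  subst e
  exact tendsto_nhds_unique h h'

/-! ### Approximation of spectral projections by polynomials -/

/-- The binomial series has radius of convergence at least one, hence converges geometrically and
uniformly on `[0, r]`. -/
theorem exists_series_one_div_sqrt {r : ℝ} (hr0 : 0 ≤ r) (hr : r < 1) :
    ∃ (c : ℕ → ℝ) (C a : ℝ), 0 ≤ C ∧ 0 < a ∧ a < 1 ∧ (∀ k, |c k| ≤ C * 2 ^ k) ∧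
      ∀ t, 0 ≤ t → t ≤ r → ∀ n, |1 / √(1 - t) - ∑ k ∈ Finset.range n, c k * t ^ k| ≤ C * a ^ n := by
  have hps := Real.one_div_one_sub_rpow_hasFPowerSeriesOnBall_zero (1 / 2)
  set c : ℕ → ℝ := fun n => Ring.choose (1 / 2 + (n : ℝ) - 1) n with hc
  have hr' : 0 ≤ (1 + r) / 2 := by linarith
  -- The midpoint of `r` and `1`: a ball that contains `[0, r]` and lies strictly inside the disc of
  -- convergence.
  obtain ⟨ρ, hρ⟩ : ∃ ρ : NNReal, (ρ : ℝ) = (1 + r) / 2 := ⟨⟨_, hr'⟩, rfl⟩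
  obtain ⟨a, ⟨ha0, ha1⟩, C, hC, h⟩ := hps.uniform_geometric_approx
    (r' := ρ) (by
      rw [ENNReal.coe_lt_one_iff, ← NNReal.coe_lt_coe, hρ, NNReal.coe_one]
      linarith)
  -- The Cauchy estimate at radius `1/2` is the source of the factor `2 ^ k`.
  obtain ⟨C', hC', h'⟩ := FormalMultilinearSeries.norm_mul_pow_le_of_lt_radius
    (FormalMultilinearSeries.ofScalars ℝ c) (r := 1 / 2) (lt_of_lt_of_le (by
      rw [ENNReal.coe_lt_one_iff, ← NNReal.coe_lt_coe]; norm_num) hps.r_le)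
  refine ⟨c, max C C', a, le_max_of_le_left hC.le, ha0, ha1, fun k => ?_, fun t ht0 htr n => ?_⟩
  · have h1 := h' k
    rw [FormalMultilinearSeries.norm_apply_eq_norm_coef,
      FormalMultilinearSeries.coeff_ofScalars, Real.norm_eq_abs] at h1
    have h2 : |c k| ≤ C' * 2 ^ k := by
      have : ((1 / 2 : NNReal) : ℝ) ^ k = (2 ^ k)⁻¹ := by
        rw [← inv_pow]; norm_num
      rw [this] at h1
      exact (mul_inv_le_iff₀ (by positivity)).1 h1
    exact h2.trans (by gcongr; exact le_max_right _ _)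
  · have h1 := h t (by
      rw [mem_ball_zero_iff, Real.norm_eq_abs, abs_of_nonneg ht0, hρ]
      linarith) n
    rw [zero_add, Real.norm_eq_abs, FormalMultilinearSeries.partialSum] at h1
    simp only [FormalMultilinearSeries.ofScalars_apply_eq, smul_eq_mul] at h1
    rw [Real.sqrt_eq_rpow]
    exact h1.trans (by gcongr; exact le_max_left _ _)

section Projection

variable {E : Type*} [NormedAddCommGroup E] [InnerProductSpace ℂ E] [CompleteSpace E]

/-- The polynomials approximating a spectral projection. -/
def approxProj (c : ℕ → ℝ) (Y : E →L[ℂ] E) (n : ℕ) : E →L[ℂ] E :=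
  (1 / 2 : ℝ) • (1 - Y * ∑ k ∈ Finset.range n, c k • (1 - Y * Y) ^ k)

/-- At distance `δ` from `μ` the jump is invisible: the indicator agrees there with a clamped affine
ramp. -/
theorem continuousOn_indicator_Iio {s : Set ℝ} {μ δ : ℝ} (hδ : 0 < δ)
    (h : ∀ x ∈ s, δ ≤ |x - μ|) :
    ContinuousOn ((Set.Iio μ).indicator fun _ => (1 : ℝ)) s := by
  have hc : Continuous fun x : ℝ => (1 - max (-1) (min 1 ((x - μ) / δ))) / 2 := by fun_prop
  refine hc.continuousOn.congr fun x hx => ?_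
  have h1 := h x hx
  rcases lt_or_ge x μ with hlt | hge
  · rw [Set.indicator_of_mem (Set.mem_Iio.2 hlt)]
    rw [abs_of_neg (by linarith)] at h1
    have : (x - μ) / δ ≤ -1 := by rw [div_le_iff₀ hδ]; linarith
    simp only
    rw [min_eq_right (this.trans (by norm_num)), max_eq_left this]
    norm_num
  · rw [Set.indicator_of_notMem (by simpa using hge)]
    rw [abs_of_nonneg (by linarith)] at h1
    have : 1 ≤ (x - μ) / δ := by rw [le_div_iff₀ hδ]; linarith
    simp only
    rw [min_eq_left this]
    norm_num

theorem spectralProjBelow_mul_self {H : E →L[ℂ] E} {μ δ : ℝ} (hδ : 0 < δ)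
    (h : ∀ x ∈ spectrum ℝ H, δ ≤ |x - μ|) :
    spectralProjBelow H μ * spectralProjBelow H μ = spectralProjBelow H μ := by
  have hc := continuousOn_indicator_Iio hδ h
  rw [spectralProjBelow, ← cfc_mul _ _ H hc hc]
  congr 1
  funext x
  by_cases hx : x ∈ Set.Iio μ <;> simp [hx]

theorem isSelfAdjoint_spectralProjBelow (H : E →L[ℂ] E) (μ : ℝ) :
    IsSelfAdjoint (spectralProjBelow H μ) := cfc_predicate _ _

/-- With `y = (x - μ)/R` the indicator is `(1 - y/|y|)/2` and `|y| = √(1 - (1 - y²))`. Expanding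
`1/|y|` in powers of `1 - y²` gives polynomials in `H`, and the functional calculus turns uniform
errors on the spectrum into norm errors. -/
theorem exists_approxProj {H : E →L[ℂ] E} (hH : IsSelfAdjoint H) {μ δ : ℝ} (hδ : 0 < δ)
    (h : ∀ x ∈ spectrum ℝ H, δ ≤ |x - μ|) :
    ∃ (R : ℝ) (c : ℕ → ℝ) (C a : ℝ), 0 ≤ C ∧ 0 < a ∧ a < 1 ∧ (∀ k, |c k| ≤ C * 2 ^ k) ∧
      ∀ n, ‖spectralProjBelow H μ - approxProj c (R • (H - μ • 1)) n‖ ≤ C * a ^ n := by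
  -- This scale forces `δ / R ≤ |y| ≤ 1` on the spectrum, so that `1 - y²` stays in `[0, 1 - (δ /
  -- R)²]`, away from the singularity at `1`.
  set R : ℝ := ‖H‖ * ‖(1 : E →L[ℂ] E)‖ + |μ| + δ with hR
  have hR0 : 0 < R := by positivity
  have hδR : δ ≤ R := by
    rw [hR]
    linarith [abs_nonneg μ, mul_nonneg (norm_nonneg H) (norm_nonneg (1 : E →L[ℂ] E))]
  have hq0 : 0 < δ / R := by positivity
  have hq1 : δ / R ≤ 1 := (div_le_one hR0).2 hδR
  obtain ⟨c, C, a, hC, ha0, ha1, hc, happ⟩ := exists_series_one_div_sqrt (r := 1 - (δ / R) ^ 2)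
    (by nlinarith) (by nlinarith)
  refine ⟨R⁻¹, c, C, a, hC, ha0, ha1, hc, fun n => ?_⟩
  let Y : Polynomial ℝ := .C R⁻¹ * (.X - .C μ)
  let Q : Polynomial ℝ := .C (1 / 2) * (1 - Y * ∑ k ∈ Finset.range n, .C (c k) * (1 - Y * Y) ^ k)
  have hQ : approxProj c (R⁻¹ • (H - μ • 1)) n = cfc Q.eval H := by
    rw [cfc_polynomial Q H hH]
    simp only [Q, Y, approxProj, map_mul, map_sub, map_sum, map_pow, map_one, Polynomial.aeval_C,
      Polynomial.aeval_X, ← Algebra.smul_def]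
    rw [Algebra.algebraMap_eq_smul_one]
  have hcont := continuousOn_indicator_Iio hδ h
  rw [hQ, spectralProjBelow, ← cfc_sub _ _ H hcont (Polynomial.continuous Q).continuousOn]
  refine norm_cfc_le (by positivity) fun x hx => ?_
  have hxδ := h x hx
  have hxR : |x - μ| ≤ R := by
    have h1 : ‖x‖ ≤ ‖H‖ * ‖(1 : E →L[ℂ] E)‖ := spectrum.norm_le_norm_mul_of_mem hx
    rw [Real.norm_eq_abs] at h1
    calc |x - μ| ≤ |x| + |μ| := abs_sub _ _
      _ ≤ R := by rw [hR]; linarith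
  set y : ℝ := R⁻¹ * (x - μ) with hy
  have hyabs : |y| = |x - μ| / R := by
    rw [hy, abs_mul, abs_of_pos (inv_pos.2 hR0)]; field_simp
  have hy1 : |y| ≤ 1 := by rw [hyabs]; exact (div_le_one hR0).2 hxR
  have hyd : δ / R ≤ |y| := by rw [hyabs]; gcongr
  have hypos : 0 < |y| := hq0.trans_le hyd
  have hyy : y * y = |y| ^ 2 := by rw [sq_abs]; ring
  have happ' := happ (1 - y * y) (by rw [hyy]; nlinarith) (by rw [hyy]; nlinarith) n
  rw [show 1 - (1 - y * y) = |y| ^ 2 by rw [hyy]; ring, Real.sqrt_sq hypos.le] at happ'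
  have hev : Q.eval x = (1 / 2) * (1 - y * ∑ k ∈ Finset.range n, c k * (1 - y * y) ^ k) := by
    simp [Q, Y, hy, Polynomial.eval_finsetSum]
  have hind : (Set.Iio μ).indicator (fun _ => (1 : ℝ)) x = (1 / 2) * (1 - y * (1 / |y|)) := by
    rcases lt_or_ge x μ with hlt | hge
    · rw [Set.indicator_of_mem (Set.mem_Iio.2 hlt)]
      have : y < 0 := mul_neg_of_pos_of_neg (inv_pos.2 hR0) (by linarith)
      rw [abs_of_neg this]
      have := this.ne
      field_simp
      norm_num
    · rw [Set.indicator_of_notMem (by simpa using hge)]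
      have h0 : 0 ≤ y := mul_nonneg (inv_pos.2 hR0).le (by linarith)
      rw [abs_of_nonneg h0] at hypos ⊢
      field_simp
      norm_num
  rw [hev, hind, Real.norm_eq_abs]
  rw [show (1 / 2) * (1 - y * (1 / |y|)) -
      (1 / 2) * (1 - y * ∑ k ∈ Finset.range n, c k * (1 - y * y) ^ k) =
      -(y / 2) * (1 / |y| - ∑ k ∈ Finset.range n, c k * (1 - y * y) ^ k) by ring, abs_mul]
  have : |-(y / 2)| ≤ 1 := by
    rw [abs_neg, abs_div, abs_two]; linarith
  calc _ ≤ 1 * (C * a ^ n) := by gcongr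
    _ = _ := one_mul _

end Projection

theorem HasSpectralGap.exists_le_abs {A : Hdisc N →L[ℂ] Hdisc N} {a b μ : ℝ}
    (h : HasSpectralGap A a b) (hμ : μ ∈ Set.Ioo a b) :
    ∃ δ, 0 < δ ∧ ∀ x ∈ spectrum ℝ A, δ ≤ |x - μ| := by
  obtain ⟨I₁, I₂, -, -, hs, h1, -, h2⟩ := h
  -- Boundedness of the spectrum makes `sSup I₁` and `sInf I₂` genuine bounds rather than default
  -- values.
  have hbd : ∀ x ∈ I₁ ∪ I₂, |x| ≤ ‖A‖ * ‖(1 : Hdisc N →L[ℂ] Hdisc N)‖ := by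
    intro x hx
    have hx' : (x : ℂ) ∈ spectrum ℂ A := by rw [hs]; exact ⟨x, hx, rfl⟩
    simpa using spectrum.norm_le_norm_mul_of_mem hx'
  refine ⟨min (μ - a) (b - μ), lt_min (sub_pos.2 hμ.1) (sub_pos.2 hμ.2), fun x hx => ?_⟩
  rw [← spectrum.preimage_algebraMap ℂ, Set.mem_preimage, hs] at hx
  obtain ⟨x', hx', e⟩ := hx
  obtain rfl : x' = x := Complex.ofReal_injective e
  rcases hx' with hx' | hx'
  · have : x' ≤ sSup I₁ :=
      le_csSup ⟨_, fun z hz => (abs_le.1 (hbd z (Or.inl hz))).2⟩ hx'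
    rw [abs_of_neg (by linarith [hμ.1])]
    exact (min_le_left _ _).trans (by linarith)
  · have : sInf I₂ ≤ x' :=
      csInf_le ⟨_, fun z hz => (abs_le.1 (hbd z (Or.inr hz))).1⟩ hx'
    rw [abs_of_pos (by linarith [hμ.2])]
    exact (min_le_right _ _).trans (by linarith)

/-! ### Weighted column norms -/

/-- The weighted column norm `sup_y ∑_x r(x, y) w(x - y)` of a kernel. -/
def colNorm (w : Lattice → ℝ≥0∞) (r : Site N → Site N → ℝ≥0∞) : ℝ≥0∞ :=
  ⨆ y, ∑' x, r x y * w (x.1 - y.1)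

/-- The kernel `|⟨δ_x, A δ_y⟩|`. -/
def absEnt (A : Hdisc N →L[ℂ] Hdisc N) (x y : Site N) : ℝ≥0∞ := ‖ent A x y‖ₑ

/-- Composition of kernels. -/
def kcomp (r s : Site N → Site N → ℝ≥0∞) (x y : Site N) : ℝ≥0∞ := ∑' u, r x u * s u y

section Weights

variable {w : Lattice → ℝ≥0∞}

theorem tsum_le_colNorm (r : Site N → Site N → ℝ≥0∞) (y : Site N) :
    ∑' x, r x y * w (x.1 - y.1) ≤ colNorm w r :=
  le_iSup (fun y : Site N => ∑' x, r x y * w (x.1 - y.1)) y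

/-- Split the weight along `x - m = (x - u) + (u - m)` by submultiplicativity and exchange the sums.
With `f` a column this makes `colNorm` submultiplicative; with `m = 0` it shows that local operators
preserve moments. -/
theorem tsum_kernel_mul_le (hw : ∀ m n, w (m + n) ≤ w m * w n) (r : Site N → Site N → ℝ≥0∞)
    (f : Site N → ℝ≥0∞) (m : Lattice) :
    ∑' x, (∑' u, r x u * f u) * w (x.1 - m) ≤ colNorm w r * ∑' u, f u * w (u.1 - m) := by
  calc ∑' x, (∑' u, r x u * f u) * w (x.1 - m)
      = ∑' x, ∑' u, r x u * f u * w (x.1 - m) := by simp only [ENNReal.tsum_mul_right]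
    _ = ∑' u, ∑' x, r x u * f u * w (x.1 - m) := ENNReal.tsum_comm
    _ ≤ ∑' u, ∑' x, r x u * w (x.1 - u.1) * (f u * w (u.1 - m)) := by
        refine ENNReal.tsum_le_tsum fun u => ENNReal.tsum_le_tsum fun x => ?_
        calc r x u * f u * w (x.1 - m) = r x u * f u * w ((x.1 - u.1) + (u.1 - m)) := by
              rw [sub_add_sub_cancel]
          _ ≤ r x u * f u * (w (x.1 - u.1) * w (u.1 - m)) := by gcongr; exact hw _ _
          _ = _ := by ring
    _ = ∑' u, (∑' x, r x u * w (x.1 - u.1)) * (f u * w (u.1 - m)) := by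
        simp only [ENNReal.tsum_mul_right]
    _ ≤ ∑' u, colNorm w r * (f u * w (u.1 - m)) := by
        refine ENNReal.tsum_le_tsum fun u => ?_
        gcongr
        exact tsum_le_colNorm r u
    _ = _ := ENNReal.tsum_mul_left

theorem colNorm_kcomp_le (hw : ∀ m n, w (m + n) ≤ w m * w n) (r s : Site N → Site N → ℝ≥0∞) :
    colNorm w (kcomp r s) ≤ colNorm w r * colNorm w s := by
  refine iSup_le fun y => (tsum_kernel_mul_le hw r (fun u => s u y) y.1).trans ?_
  gcongr
  exact tsum_le_colNorm s y

theorem colNorm_mono {r s : Site N → Site N → ℝ≥0∞} (h : ∀ x y, r x y ≤ s x y) :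
    colNorm w r ≤ colNorm w s := by
  refine iSup_mono fun y => ENNReal.tsum_le_tsum fun x => ?_
  gcongr
  exact h x y

theorem absEnt_mul_le (A B : Hdisc N →L[ℂ] Hdisc N) (x y : Site N) :
    absEnt (A * B) x y ≤ kcomp (absEnt A) (absEnt B) x y := by
  rw [absEnt, ent_mul]
  refine enorm_tsum_le_tsum_enorm.trans (le_of_eq (tsum_congr fun u => ?_))
  rw [enorm_mul]; rfl

theorem colNorm_mul_le (hw : ∀ m n, w (m + n) ≤ w m * w n) (A B : Hdisc N →L[ℂ] Hdisc N) :
    colNorm w (absEnt (A * B)) ≤ colNorm w (absEnt A) * colNorm w (absEnt B) :=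
  (colNorm_mono (absEnt_mul_le A B)).trans (colNorm_kcomp_le hw _ _)

theorem colNorm_add_le_of_le {r s t : Site N → Site N → ℝ≥0∞}
    (h : ∀ x y, r x y ≤ s x y + t x y) : colNorm w r ≤ colNorm w s + colNorm w t := by
  refine iSup_le fun y => ?_
  calc _ ≤ ∑' x, (s x y * w (x.1 - y.1) + t x y * w (x.1 - y.1)) := by
        refine ENNReal.tsum_le_tsum fun x => ?_
        rw [← add_mul]
        gcongr
        exact h x y
    _ = _ := ENNReal.tsum_add
    _ ≤ _ := add_le_add (tsum_le_colNorm s y) (tsum_le_colNorm t y)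

theorem colNorm_add_le (A B : Hdisc N →L[ℂ] Hdisc N) :
    colNorm w (absEnt (A + B)) ≤ colNorm w (absEnt A) + colNorm w (absEnt B) := by
  refine colNorm_add_le_of_le fun x y => ?_
  simp only [absEnt, ent_add]
  exact enorm_add_le _ _

theorem colNorm_sub_le (A B : Hdisc N →L[ℂ] Hdisc N) :
    colNorm w (absEnt (A - B)) ≤ colNorm w (absEnt A) + colNorm w (absEnt B) := by
  refine colNorm_add_le_of_le fun x y => ?_
  simp only [absEnt, ent_sub]
  exact enorm_sub_le

theorem colNorm_smul (c : ℝ) (A : Hdisc N →L[ℂ] Hdisc N) :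
    colNorm w (absEnt (c • A)) = ‖c‖ₑ * colNorm w (absEnt A) := by
  simp only [colNorm, absEnt, ent_real_smul, enorm_mul, mul_assoc, ENNReal.tsum_mul_left,
    ENNReal.mul_iSup]
  congr! 3
  simp [← ofReal_norm]

theorem colNorm_one_le (h0 : w 0 ≤ 1) : colNorm w (absEnt (1 : Hdisc N →L[ℂ] Hdisc N)) ≤ 1 := by
  refine iSup_le fun y => ?_
  rw [tsum_eq_single y fun x hx => by simp [absEnt, ent_one, hx]]
  simpa [absEnt, ent_one] using h0

theorem colNorm_pow_le (hw : ∀ m n, w (m + n) ≤ w m * w n) (h0 : w 0 ≤ 1)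
    (A : Hdisc N →L[ℂ] Hdisc N) (k : ℕ) :
    colNorm w (absEnt (A ^ k)) ≤ colNorm w (absEnt A) ^ k := by
  induction k with
  | zero => simpa using colNorm_one_le h0
  | succ k ih =>
    rw [pow_succ, pow_succ]
    refine (colNorm_mul_le hw _ _).trans ?_
    gcongr

theorem colNorm_sum_le {ι : Type*} (s : Finset ι) (A : ι → Hdisc N →L[ℂ] Hdisc N) :
    colNorm w (absEnt (∑ i ∈ s, A i)) ≤ ∑ i ∈ s, colNorm w (absEnt (A i)) := by
  classical
  induction s using Finset.induction_on with
  | empty => simp [colNorm, absEnt, ent]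
  | insert i s hi ih =>
    rw [Finset.sum_insert hi, Finset.sum_insert hi]
    exact (colNorm_add_le _ _).trans (by gcongr)

/-- Only the exponential form `F ^ n` of the growth matters; the size of `F` is irrelevant later. -/
theorem colNorm_approxProj_le (hw : ∀ m n, w (m + n) ≤ w m * w n) (h0 : w 0 ≤ 1)
    {Y : Hdisc N →L[ℂ] Hdisc N} (hY : colNorm w (absEnt Y) ≠ ∞) {c : ℕ → ℝ} {C : ℝ} (hC : 0 ≤ C)
    (hc : ∀ k, |c k| ≤ C * 2 ^ k) :
    ∃ K F : ℝ, 0 ≤ K ∧ 1 ≤ F ∧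
      ∀ n, colNorm w (absEnt (approxProj c Y n)) ≤ ENNReal.ofReal (K * F ^ n) := by
  set m : ℝ := (colNorm w (absEnt Y)).toReal with hm
  have hm0 : 0 ≤ m := ENNReal.toReal_nonneg
  have hYm : colNorm w (absEnt Y) = ENNReal.ofReal m := (ENNReal.ofReal_toReal hY).symm
  have hT : colNorm w (absEnt (1 - Y * Y)) ≤ ENNReal.ofReal (1 + m * m) := by
    rw [ENNReal.ofReal_add zero_le_one (by positivity), ENNReal.ofReal_mul hm0, ← hYm]
    refine (colNorm_sub_le _ _).trans ?_
    gcongr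
    · simpa using colNorm_one_le h0
    · exact colNorm_mul_le hw _ _
  -- In `F`, the factor `1 + m * m` bounds `1 - Y²`, one `2` comes from the coefficients, and the
  -- other absorbs the number of terms through `n ≤ 2 ^ n`.
  refine ⟨1 + m * C, 2 * (2 * (1 + m * m)), by positivity, by nlinarith, fun n => ?_⟩
  have hS : colNorm w (absEnt (∑ k ∈ Finset.range n, c k • (1 - Y * Y) ^ k)) ≤
      ENNReal.ofReal (C * (2 * (2 * (1 + m * m))) ^ n) := by
    refine (colNorm_sum_le _ _).trans ?_
    calc _ ≤ ∑ k ∈ Finset.range n, ENNReal.ofReal (C * (2 * (1 + m * m)) ^ n) := by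
          refine Finset.sum_le_sum fun k hk => ?_
          rw [colNorm_smul]
          calc _ ≤ ENNReal.ofReal (C * 2 ^ k) * ENNReal.ofReal (1 + m * m) ^ k := by
                gcongr
                · rw [← ofReal_norm]
                  exact ENNReal.ofReal_le_ofReal (hc k)
                · exact (colNorm_pow_le hw h0 _ _).trans (by gcongr)
            _ = ENNReal.ofReal (C * (2 * (1 + m * m)) ^ k) := by
                rw [← ENNReal.ofReal_pow (by positivity), ← ENNReal.ofReal_mul (by positivity),
                  mul_assoc, ← mul_pow]
            _ ≤ _ := by
                refine ENNReal.ofReal_le_ofReal ?_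
                gcongr
                · nlinarith
                · exact (Finset.mem_range.1 hk).le
      _ = ENNReal.ofReal (n * (C * (2 * (1 + m * m)) ^ n)) := by
          rw [Finset.sum_const, Finset.card_range, nsmul_eq_mul,
            ENNReal.ofReal_mul (Nat.cast_nonneg n), ENNReal.ofReal_natCast]
      _ ≤ _ := by
          refine ENNReal.ofReal_le_ofReal ?_
          rw [mul_pow 2 (2 * (1 + m * m)), mul_left_comm C]
          gcongr
          exact_mod_cast Nat.lt_two_pow_self.le
  refine (colNorm_smul (w := w) (1 / 2) _).le.trans ?_
  calc _ ≤ 1 * (1 + ENNReal.ofReal m * ENNReal.ofReal (C * (2 * (2 * (1 + m * m))) ^ n)) := by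
        gcongr
        · rw [← ofReal_norm, ← ENNReal.ofReal_one]
          exact ENNReal.ofReal_le_ofReal (by norm_num)
        · refine (colNorm_sub_le _ _).trans ?_
          gcongr
          · exact colNorm_one_le h0
          · refine (colNorm_mul_le hw _ _).trans ?_
            rw [← hYm]
            gcongr
            exact hS
    _ = ENNReal.ofReal (1 + m * (C * (2 * (2 * (1 + m * m))) ^ n)) := by
        rw [one_mul, ← ENNReal.ofReal_mul hm0, ENNReal.ofReal_add zero_le_one (by positivity),
          ENNReal.ofReal_one]
    _ ≤ _ := by
        refine ENNReal.ofReal_le_ofReal ?_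
        have : 1 ≤ (2 * (2 * (1 + m * m))) ^ n := one_le_pow₀ (by nlinarith)
        rw [add_mul, mul_assoc m C]
        linarith

end Weights

/-- Take `n ≈ ε t`: then `a ^ n` decays exponentially in `t`, and for small `ε` the growth `F ^ n`
uses up at most half of the rate `c`. -/
theorem exp_decay_of_geometric {C K a F c : ℝ} (hC : 0 ≤ C) (hK : 0 ≤ K) (ha0 : 0 < a)
    (ha1 : a < 1) (hF : 1 ≤ F) (hc : 0 < c) :
    ∃ C' c' : ℝ, 0 < c' ∧ ∀ t v : ℝ, 0 ≤ t →
      (∀ n : ℕ, v ≤ C * a ^ n + K * F ^ n * Real.exp (-c * t)) → v ≤ C' * Real.exp (-c' * t) := by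
  have hlF : 0 ≤ Real.log F := Real.log_nonneg hF
  have hla : Real.log a < 0 := Real.log_neg ha0 ha1
  -- Chosen so that `ε log F ≤ c / 2`; the `+ 1` keeps the denominator positive when `F = 1`.
  set ε : ℝ := c / (2 * (Real.log F + 1)) with hε
  have hε0 : 0 < ε := by positivity
  set c' : ℝ := min (c / 2) (ε * -Real.log a) with hc'
  have hc'1 : c' ≤ c / 2 := min_le_left _ _
  have hc'2 : c' ≤ ε * -Real.log a := min_le_right _ _
  refine ⟨C / a + K, c', lt_min (by positivity) (mul_pos hε0 (by linarith)), fun t v ht hv => ?_⟩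
  have h := hv ⌊ε * t⌋₊
  have hn1 : (⌊ε * t⌋₊ : ℝ) ≤ ε * t := Nat.floor_le (by positivity)
  have hn2 : ε * t < ⌊ε * t⌋₊ + 1 := Nat.lt_floor_add_one _
  set n := ⌊ε * t⌋₊
  -- The factor `a⁻¹` pays for rounding `ε t` down to an integer.
  have h1 : a ^ n ≤ a⁻¹ * Real.exp (-c' * t) := by
    rw [← Real.exp_log ha0, ← Real.exp_nat_mul, ← Real.exp_neg, ← Real.exp_add]
    refine Real.exp_le_exp.2 ?_
    have : c' * t ≤ ε * -Real.log a * t := by gcongr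
    nlinarith
  have h2 : F ^ n * Real.exp (-c * t) ≤ Real.exp (-c' * t) := by
    rw [← Real.exp_log (by linarith : 0 < F), ← Real.exp_nat_mul, ← Real.exp_add]
    refine Real.exp_le_exp.2 ?_
    have e1 : (n : ℝ) * Real.log F ≤ ε * t * Real.log F := by gcongr
    have e2 : ε * Real.log F ≤ c / 2 := by
      rw [hε, div_mul_eq_mul_div, div_le_div_iff₀ (by positivity) (by positivity)]
      nlinarith
    have e3 : c' * t ≤ c / 2 * t := by gcongr
    nlinarith
  calc v ≤ C * a ^ n + K * F ^ n * Real.exp (-c * t) := h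
    _ ≤ C * (a⁻¹ * Real.exp (-c' * t)) + K * Real.exp (-c' * t) := by
        rw [mul_assoc K]
        gcongr
    _ = _ := by rw [div_eq_mul_inv]; ring

/-! ### Exponential and polynomial weights -/

/-- The exponential weight `exp (c ‖n‖)`. -/
def expWeight (c : ℝ) (n : Lattice) : ℝ≥0∞ := ENNReal.ofReal (Real.exp (c * ‖n‖))

theorem expWeight_add_le {c : ℝ} (hc : 0 ≤ c) (m n : Lattice) :
    expWeight c (m + n) ≤ expWeight c m * expWeight c n := by
  rw [expWeight, expWeight, expWeight, ← ENNReal.ofReal_mul (Real.exp_nonneg _), ← Real.exp_add]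
  refine ENNReal.ofReal_le_ofReal (Real.exp_le_exp.2 ?_)
  rw [← mul_add]
  gcongr
  exact norm_add_le m n

/-- The polynomial weight `(1 + ‖n‖) ^ k`. -/
def polyWeight (k : ℕ) (n : Lattice) : ℝ≥0∞ := (1 + ‖n‖ₑ) ^ k

theorem polyWeight_add_le (k : ℕ) (m n : Lattice) :
    polyWeight k (m + n) ≤ polyWeight k m * polyWeight k n := by
  rw [polyWeight, polyWeight, polyWeight, ← mul_pow]
  gcongr
  calc 1 + ‖m + n‖ₑ ≤ 1 + (‖m‖ₑ + ‖n‖ₑ) := by gcongr; exact enorm_add_le m n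
    _ ≤ 1 + (‖m‖ₑ + ‖n‖ₑ) + ‖m‖ₑ * ‖n‖ₑ := le_self_add
    _ = _ := by ring

/-- Comparison with `‖n‖ ^ (-3)`, which is summable over a two-dimensional lattice. -/
theorem summable_pow_mul_exp {c : ℝ} (hc : 0 < c) (k : ℕ) :
    Summable fun n : Lattice => (1 + ‖n‖) ^ k * Real.exp (-c * ‖n‖) := by
  have h3 := EisensteinSeries.summable_one_div_norm_rpow (k := 3) (by norm_num)
  obtain ⟨M, hM⟩ : ∃ M : ℝ, ∀ t : ℝ, 0 ≤ t → (1 + t) ^ k * t ^ 3 * Real.exp (-c * t) ≤ M := by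
    refine ⟨Real.exp c * ((k + 3).factorial / c ^ (k + 3)), fun t ht => ?_⟩
    have h1 := Real.pow_div_factorial_le_exp (c * (1 + t)) (by positivity) (k + 3)
    have h2 : (1 + t) ^ (k + 3) ≤ (k + 3).factorial / c ^ (k + 3) * Real.exp (c * (1 + t)) := by
      rw [mul_pow, div_le_iff₀ (by positivity)] at h1
      rw [div_mul_eq_mul_div, le_div_iff₀ (by positivity)]
      linarith
    calc (1 + t) ^ k * t ^ 3 * Real.exp (-c * t)
        ≤ (1 + t) ^ k * (1 + t) ^ 3 * Real.exp (-c * t) := by gcongr; linarith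
      _ = (1 + t) ^ (k + 3) * Real.exp (-c * t) := by rw [pow_add]
      _ ≤ (k + 3).factorial / c ^ (k + 3) * Real.exp (c * (1 + t)) * Real.exp (-c * t) := by gcongr
      _ = _ := by
        rw [mul_assoc, ← Real.exp_add, show c * (1 + t) + -c * t = c by ring, mul_comm]
  refine Summable.of_norm_bounded_eventually (h3.mul_left M) ?_
  refine (Set.finite_singleton (0 : Lattice)).subset fun n hn => ?_
  by_contra h0
  apply hn
  rw [Set.mem_ofPred_eq]
  have hpos : 0 < ‖n‖ := norm_pos_iff.2 h0
  rw [Real.norm_of_nonneg (by positivity), Real.rpow_neg hpos.le]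
  rw [← div_eq_mul_inv, le_div_iff₀ (by positivity)]
  have := hM ‖n‖ hpos.le
  norm_cast
  calc _ = _ := by ring
    _ ≤ M := this

theorem colNorm_polyWeight_ne_top {r : Site N → Site N → ℝ≥0∞} {C c : ℝ} (hc : 0 < c)
    (h : ∀ x y, r x y ≤ ENNReal.ofReal (C * Real.exp (-c * ‖x.1 - y.1‖))) (k : ℕ) :
    colNorm (polyWeight k) r ≠ ∞ := by
  have hs := (summable_pow_mul_exp hc k).mul_left |C|
  refine ne_top_of_le_ne_top (b := ∑' _ : Internal N, ∑' n : Lattice, ENNReal.ofReal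
    (|C| * ((1 + ‖n‖) ^ k * Real.exp (-c * ‖n‖)))) ?_ ?_
  · rw [tsum_fintype]
    refine (ENNReal.sum_ne_top).2 fun i _ => ?_
    rw [← ENNReal.ofReal_tsum_of_nonneg (fun n => by positivity) hs]
    exact ENNReal.ofReal_ne_top
  · refine iSup_le fun y => ?_
    rw [← (Equiv.prodComm (Internal N) Lattice).tsum_eq, ENNReal.tsum_prod']
    refine ENNReal.tsum_le_tsum fun i => ?_
    rw [← (Equiv.addRight y.1).tsum_eq]
    refine ENNReal.tsum_le_tsum fun n => ?_
    simp only [Equiv.prodComm_apply, Equiv.coe_addRight, Prod.swap_prod_mk, add_sub_cancel_right]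
    refine (mul_le_mul_left (h _ _) _).trans ?_
    simp only [add_sub_cancel_right]
    have hp : polyWeight k (n) = ENNReal.ofReal ((1 + ‖n‖) ^ k) := by
      rw [polyWeight, ENNReal.ofReal_pow (by positivity), ENNReal.ofReal_add zero_le_one
        (norm_nonneg _), ENNReal.ofReal_one, ofReal_norm]
    rw [hp, ← ENNReal.ofReal_mul' (by positivity)]
    refine ENNReal.ofReal_le_ofReal ?_
    calc _ ≤ |C| * Real.exp (-c * ‖n‖) * (1 + ‖n‖) ^ k := by
          gcongr; exact le_abs_self C
      _ = _ := by ring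

/-! ### The Fermi projection is local and periodic -/

/-- Translation of a site by a lattice vector. -/
def trans (p : Lattice) : Site N ≃ Site N := (Equiv.addRight p).prodCongr (Equiv.refl _)

@[simp]
theorem trans_apply (p n : Lattice) (i : Internal N) : trans p (n, i) = (n + p, i) := rfl

@[simp]
theorem trans_fst (p : Lattice) (x : Site N) : (trans p x).1 = x.1 + p := rfl

/-- The algebra of bounded operators with a periodic kernel. -/
def periodicSubalgebra (N : ℕ) : Subalgebra ℝ (Hdisc N →L[ℂ] Hdisc N) where
  carrier := {A | ∀ p x y, ent A (trans p x) (trans p y) = ent A x y}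
  mul_mem' := fun {A B} hA hB p x y => by
    rw [ent_mul, ent_mul, ← (trans p).tsum_eq]
    exact tsum_congr fun u => by rw [hA, hB]
  add_mem' := fun {A B} hA hB p x y => by rw [ent_add, ent_add, hA, hB]
  algebraMap_mem' := fun r p x y => by
    rw [Algebra.algebraMap_eq_smul_one, ent_real_smul, ent_real_smul, ent_one, ent_one]
    simp only [EmbeddingLike.apply_eq_iff_eq]

theorem approxProj_mem_periodicSubalgebra {Y : Hdisc N →L[ℂ] Hdisc N}
    (hY : Y ∈ periodicSubalgebra N) (c : ℕ → ℝ) (n : ℕ) :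
    approxProj c Y n ∈ periodicSubalgebra N := by
  refine Subalgebra.smul_mem _ (sub_mem (one_mem _) (mul_mem hY (sum_mem fun k _ => ?_))) _
  exact Subalgebra.smul_mem _ (pow_mem (sub_mem (one_mem _) (mul_mem hY hY)) _) _

theorem norm_entry_le_toEuclideanCLM {ι : Type*} [Fintype ι] [DecidableEq ι] (M : Matrix ι ι ℂ)
    (i k : ι) : ‖M i k‖ ≤ ‖Matrix.toEuclideanCLM (𝕜 := ℂ) M‖ := by
  have h := (Matrix.toEuclideanCLM (𝕜 := ℂ) M).le_opNorm (EuclideanSpace.single k 1)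
  rw [PiLp.norm_single, norm_one, mul_one] at h
  refine le_trans ?_ ((PiLp.norm_apply_le _ i).trans h)
  simp [EuclideanSpace.single]

theorem IsNearSighted.norm_ent_le {A : Hdisc N →L[ℂ] Hdisc N} (h : IsNearSighted A) :
    ∃ C c : ℝ, 0 < c ∧ ∀ x y, ‖ent A x y‖ ≤ C * Real.exp (-c * ‖x.1 - y.1‖) := by
  obtain ⟨C, ζ, hC, hζ, h⟩ := h
  refine ⟨C, 1 / ζ, by positivity, fun x y => ?_⟩
  obtain ⟨m, i⟩ := x
  obtain ⟨n, k⟩ := y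
  have h1 := (norm_entry_le_toEuclideanCLM (kernel (ofBounded A) m n) i k).trans (h m n)
  rw [kernel_ofBounded] at h1
  refine h1.trans ?_
  refine mul_le_mul_of_nonneg_left (Real.exp_le_exp.2 ?_) hC.le
  rw [neg_mul, neg_mul]
  refine neg_le_neg (mul_le_mul_of_nonneg_left ?_ (by positivity))
  refine (pi_norm_le_iff_of_nonneg (Finset.sum_nonneg fun _ _ => abs_nonneg _)).2 fun j => ?_
  have := Finset.single_le_sum (f := fun j => |((m j : ℝ) - n j)|) (fun _ _ => abs_nonneg _)
    (Finset.mem_univ j)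
  refine le_trans (le_of_eq ?_) this
  simp [Int.norm_eq_abs]

/-- Half of the decay rate pays for the weight, the other half for the summation. -/
theorem colNorm_expWeight_ne_top {A : Hdisc N →L[ℂ] Hdisc N} {C c : ℝ} (hc : 0 < c)
    (h : ∀ x y, ‖ent A x y‖ ≤ C * Real.exp (-c * ‖x.1 - y.1‖)) :
    colNorm (expWeight (c / 2)) (absEnt A) ≠ ∞ := by
  have h1 := colNorm_polyWeight_ne_top (N := N) (r := fun x y =>
    absEnt A x y * expWeight (c / 2) (x.1 - y.1)) (C := C) (half_pos hc) (fun x y => by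
      rw [absEnt, expWeight, ← ofReal_norm, ← ENNReal.ofReal_mul (norm_nonneg _)]
      refine ENNReal.ofReal_le_ofReal ?_
      calc _ ≤ C * Real.exp (-c * ‖x.1 - y.1‖) * Real.exp (c / 2 * ‖x.1 - y.1‖) := by
            gcongr
            exact h x y
        _ = _ := by
            rw [mul_assoc, ← Real.exp_add]
            congr 2
            ring) 0
  simpa [colNorm, polyWeight] using h1

theorem norm_ent_le_of_colNorm_le {A : Hdisc N →L[ℂ] Hdisc N} {c K : ℝ} (hK : 0 ≤ K)
    (h : colNorm (expWeight c) (absEnt A) ≤ ENNReal.ofReal K) (x y : Site N) :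
    ‖ent A x y‖ ≤ K * Real.exp (-c * ‖x.1 - y.1‖) := by
  have h1 := (ENNReal.le_tsum (f := fun x => absEnt A x y * expWeight c (x.1 - y.1)) x).trans
    ((tsum_le_colNorm (absEnt A) y).trans h)
  rw [absEnt, expWeight, ← ofReal_norm, ← ENNReal.ofReal_mul (norm_nonneg _),
    ENNReal.ofReal_le_ofReal_iff hK] at h1
  rw [neg_mul, Real.exp_neg, ← div_eq_mul_inv, le_div_iff₀ (Real.exp_pos _)]
  exact h1

/-- A periodic orthogonal projection whose kernel has finite moments. -/
structure IsLocalProj (P : Hdisc N →L[ℂ] Hdisc N) : Prop where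
  mul_self : P * P = P
  symm : ∀ x y, ent P y x = star (ent P x y)
  periodic : ∀ p x y, ent P (trans p x) (trans p y) = ent P x y
  colNorm_ne_top : ∀ k, colNorm (polyWeight k) (absEnt P) ≠ ∞

/-- Decay of the entries results from balancing the norm error of the approximating polynomials
against their weighted column norms. Periodicity holds for polynomials in `H` and survives entrywise
limits. -/
theorem isLocalProj_fermi {H : Hdisc N →L[ℂ] Hdisc N} (hsa : IsSelfAdjoint H)
    (hns : IsNearSighted H) (hper : IsPeriodic H) {a b μ : ℝ} (hgap : HasSpectralGap H a b)
    (hμ : μ ∈ Set.Ioo a b) : IsLocalProj (fermi H μ) := by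
  obtain ⟨δ, hδ, hspec⟩ := hgap.exists_le_abs hμ
  obtain ⟨R, c, C, q, hC, hq0, hq1, hc, happ⟩ := exists_approxProj hsa hδ hspec
  obtain ⟨CH, z, hz, hdec⟩ := hns.norm_ent_le
  set Y : Hdisc N →L[ℂ] Hdisc N := R • (H - μ • 1)
  have hYper : Y ∈ periodicSubalgebra N := by
    have hH : H ∈ periodicSubalgebra N := by
      rintro p ⟨m, i⟩ ⟨n, k⟩
      have h := congrFun (congrFun (hper (m + p) (n + p) p) i) k
      rwa [kernel_ofBounded, kernel_ofBounded, add_sub_cancel_right, add_sub_cancel_right] at h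
    exact Subalgebra.smul_mem _ (sub_mem hH (Subalgebra.smul_mem _ (one_mem _) _)) _
  have hw0 : expWeight (z / 2) 0 ≤ 1 := by simp [expWeight]
  have hw := expWeight_add_le (half_pos hz).le
  have hYfin : colNorm (expWeight (z / 2)) (absEnt Y) ≠ ∞ := by
    refine ne_top_of_le_ne_top ?_ (colNorm_smul (w := expWeight (z / 2)) R _).le
    refine ENNReal.mul_ne_top (by simp) (ne_top_of_le_ne_top ?_ (colNorm_sub_le _ _))
    refine ENNReal.add_ne_top.2 ⟨colNorm_expWeight_ne_top hz hdec, ?_⟩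
    refine ne_top_of_le_ne_top ?_ (colNorm_smul (w := expWeight (z / 2)) μ _).le
    exact ENNReal.mul_ne_top (by simp) (ne_top_of_le_ne_top ENNReal.one_ne_top (colNorm_one_le hw0))
  obtain ⟨K, F, hK, hF, hcol⟩ := colNorm_approxProj_le hw hw0 hYfin hC hc
  obtain ⟨C', c', hc', hexp⟩ := exp_decay_of_geometric hC hK hq0 hq1 hF (half_pos hz)
  have hPdec : ∀ x y, ‖ent (fermi H μ) x y‖ ≤ C' * Real.exp (-c' * ‖x.1 - y.1‖) := by
    refine fun x y => hexp _ _ (norm_nonneg _) fun n => ?_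
    have e : ent (fermi H μ) x y = ent (fermi H μ - approxProj c Y n) x y +
        ent (approxProj c Y n) x y := by rw [ent_sub, sub_add_cancel]
    rw [e]
    refine (norm_add_le _ _).trans (add_le_add ((norm_ent_le _ _ _).trans (happ n)) ?_)
    exact norm_ent_le_of_colNorm_le (by positivity) (hcol n) x y
  refine ⟨spectralProjBelow_mul_self hδ hspec, fun x y => ?_, fun p x y => ?_, fun k => ?_⟩
  · have hP : IsSelfAdjoint (fermi H μ) := isSelfAdjoint_spectralProjBelow H μ
    rw [ent, ent, ← ContinuousLinearMap.adjoint_inner_left, ← ContinuousLinearMap.star_eq_adjoint,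
      hP.star_eq]
    exact (inner_conj_symm _ _).symm
  · have hlim : ∀ x y : Site N, Filter.Tendsto (fun n => ent (approxProj c Y n) x y) Filter.atTop
        (nhds (ent (fermi H μ) x y)) := by
      intro x y
      rw [tendsto_iff_norm_sub_tendsto_zero]
      refine squeeze_zero (fun _ => norm_nonneg _) (fun n => ?_)
        (by simpa using (tendsto_pow_atTop_nhds_zero_of_lt_one hq0.le hq1).const_mul C)
      rw [norm_sub_rev, ← ent_sub]
      exact (norm_ent_le _ _ _).trans (happ n)
    refine tendsto_nhds_unique (hlim _ _) ((hlim x y).congr fun n => ?_)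
    exact (approxProj_mem_periodicSubalgebra hYper c n p x y).symm
  · refine colNorm_polyWeight_ne_top (C := C') hc' (fun x y => ?_) k
    rw [absEnt, ← ofReal_norm]
    exact ENNReal.ofReal_le_ofReal (hPdec x y)

/-! ### Functions of polynomial growth and rapidly decaying vectors -/

/-- Polynomial growth of a function of one site. -/
def PolyBdd (f : Site N → ℝ) : Prop :=
  ∃ C : ℝ≥0∞, C ≠ ∞ ∧ ∃ k, ∀ x, ‖f x‖ₑ ≤ C * polyWeight k x.1

/-- Polynomial growth of a function of two sites. -/
def PolyBdd₂ (h : Site N → Site N → ℝ) : Prop :=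
  ∃ C : ℝ≥0∞, C ≠ ∞ ∧ ∃ k, ∀ u v, ‖h u v‖ₑ ≤ C * (polyWeight k u.1 * polyWeight k v.1)

theorem polyWeight_ne_top (k : ℕ) (n : Lattice) : polyWeight k n ≠ ∞ := by
  simp [polyWeight]

theorem polyWeight_mono {k l : ℕ} (h : k ≤ l) (n : Lattice) : polyWeight k n ≤ polyWeight l n :=
  pow_le_pow_right₀ le_self_add h

theorem PolyBdd.of_bounded {f : Site N → ℝ} {C : ℝ} (h : ∀ x, |f x| ≤ C) : PolyBdd f := by
  refine ⟨ENNReal.ofReal C, ENNReal.ofReal_ne_top, 0, fun x => ?_⟩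
  rw [polyWeight, pow_zero, mul_one, ← ofReal_norm]
  exact ENNReal.ofReal_le_ofReal (h x)

theorem PolyBdd.const (c : ℝ) : PolyBdd fun _ : Site N => c :=
  .of_bounded fun _ => le_rfl

theorem PolyBdd.of_affine {f : Site N → ℝ} {C : ℝ} (hC : 0 ≤ C)
    (h : ∀ x, |f x| ≤ C * (1 + ‖x.1‖)) : PolyBdd f := by
  refine ⟨ENNReal.ofReal C, ENNReal.ofReal_ne_top, 1, fun x => ?_⟩
  rw [polyWeight, pow_one, ← ofReal_norm, ← ofReal_norm, ← ENNReal.ofReal_one,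
    ← ENNReal.ofReal_add zero_le_one (norm_nonneg _), ← ENNReal.ofReal_mul hC]
  exact ENNReal.ofReal_le_ofReal (h x)

theorem PolyBdd.coord (j : Fin 2) : PolyBdd fun x : Site N => (x.1 j : ℝ) := by
  refine .of_affine zero_le_one fun x => ?_
  have h := norm_le_pi_norm x.1 j
  rw [Int.norm_eq_abs] at h
  linarith

theorem PolyBdd.mul {f g : Site N → ℝ} (hf : PolyBdd f) (hg : PolyBdd g) :
    PolyBdd fun x => f x * g x := by
  obtain ⟨C, hC, k, hf⟩ := hf
  obtain ⟨D, hD, l, hg⟩ := hg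
  refine ⟨C * D, ENNReal.mul_ne_top hC hD, k + l, fun x => ?_⟩
  rw [enorm_mul, polyWeight, pow_add, mul_mul_mul_comm]
  exact mul_le_mul' (hf x) (hg x)

theorem PolyBdd₂.mul {f g : Site N → ℝ} (hf : PolyBdd f) (hg : PolyBdd g) :
    PolyBdd₂ fun u v => f u * g v := by
  obtain ⟨C, hC, k, hf⟩ := hf
  obtain ⟨D, hD, l, hg⟩ := hg
  refine ⟨C * D, ENNReal.mul_ne_top hC hD, max k l, fun u v => ?_⟩
  rw [enorm_mul, mul_mul_mul_comm]
  refine mul_le_mul' ((hf u).trans ?_) ((hg v).trans ?_)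
  · gcongr; exact polyWeight_mono (le_max_left _ _) _
  · gcongr; exact polyWeight_mono (le_max_right _ _) _

theorem PolyBdd₂.fst {f : Site N → ℝ} (hf : PolyBdd f) : PolyBdd₂ fun u _ => f u := by
  simpa using PolyBdd₂.mul hf (PolyBdd.const 1)

theorem PolyBdd₂.snd {f : Site N → ℝ} (hf : PolyBdd f) : PolyBdd₂ fun _ v => f v := by
  simpa using PolyBdd₂.mul (PolyBdd.const 1) hf

theorem PolyBdd₂.sub {f g : Site N → Site N → ℝ} (hf : PolyBdd₂ f) (hg : PolyBdd₂ g) :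
    PolyBdd₂ fun u v => f u v - g u v := by
  obtain ⟨C, hC, k, hf⟩ := hf
  obtain ⟨D, hD, l, hg⟩ := hg
  refine ⟨C + D, ENNReal.add_ne_top.2 ⟨hC, hD⟩, max k l, fun u v => ?_⟩
  refine enorm_sub_le.trans ?_
  rw [add_mul]
  refine add_le_add ((hf u v).trans ?_) ((hg u v).trans ?_)
  · gcongr <;> exact polyWeight_mono (le_max_left _ _) _
  · gcongr <;> exact polyWeight_mono (le_max_right _ _) _

theorem PolyBdd₂.const_mul {f : Site N → Site N → ℝ} (c : ℝ) (hf : PolyBdd₂ f) :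
    PolyBdd₂ fun u v => c * f u v := by
  obtain ⟨C, hC, k, hf⟩ := hf
  refine ⟨‖c‖ₑ * C, ENNReal.mul_ne_top enorm_ne_top hC, k, fun u v => ?_⟩
  rw [enorm_mul, mul_assoc]
  gcongr
  exact hf u v

theorem PolyBdd.trans {f : Site N → ℝ} (hf : PolyBdd f) (p : Lattice) :
    PolyBdd fun x => f (trans p x) := by
  obtain ⟨C, hC, k, hf⟩ := hf
  refine ⟨C * polyWeight k p, ENNReal.mul_ne_top hC (polyWeight_ne_top _ _), k, fun x => ?_⟩
  refine (hf _).trans ?_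
  rw [mul_assoc, mul_comm (polyWeight k p)]
  gcongr
  exact polyWeight_add_le _ _ _

/-- Vectors all of whose moments are finite. -/
def Rapid (φ : Hdisc N) : Prop := ∀ k, ∑' x, ‖φ x‖ₑ * polyWeight k x.1 ≠ ∞

theorem rapid_delta (y : Site N) : Rapid (delta y : Hdisc N) := by
  intro k
  rw [tsum_eq_single y fun x hx => by simp [delta_apply, hx]]
  simpa [delta_apply] using polyWeight_ne_top k y.1

/-- Vectors with all moments finite are stable under `P` and under multiplication by functions of
polynomial growth, so they lie in every natural domain occurring in the Kubo operators. -/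
theorem IsLocalProj.rapid_apply {P : Hdisc N →L[ℂ] Hdisc N} (hP : IsLocalProj P) {φ : Hdisc N}
    (hφ : Rapid φ) : Rapid (P φ) := by
  intro k
  refine ne_top_of_le_ne_top (ENNReal.mul_ne_top (hP.colNorm_ne_top k) (hφ k)) ?_
  have h := tsum_kernel_mul_le (polyWeight_add_le k) (absEnt P) (fun u => ‖φ u‖ₑ) 0
  simp only [sub_zero] at h
  refine le_trans (ENNReal.tsum_le_tsum fun x => ?_) h
  gcongr
  rw [apply_eq_tsum]
  refine enorm_tsum_le_tsum_enorm.trans (le_of_eq (tsum_congr fun u => ?_))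
  rw [enorm_mul]; rfl

theorem memℓp_two_of_tsum_enorm_ne_top {f : Site N → ℂ} (h : ∑' x, ‖f x‖ₑ ≠ ∞) : Memℓp f 2 := by
  refine Memℓp.of_exponent_ge (q := 1) (memℓp_gen ?_) (by norm_num)
  have := ENNReal.summable_toReal h
  simpa using this

open Classical in
/-- The product of a function and a vector, when it is square-summable. -/
def mulVec (f : Site N → ℝ) (φ : Hdisc N) : Hdisc N :=
  if h : Memℓp (fun x => (f x : ℂ) * φ x) 2 then ⟨fun x => (f x : ℂ) * φ x, h⟩ else 0

theorem tsum_enorm_mul_ne_top {f : Site N → ℝ} (hf : PolyBdd f) {φ : Hdisc N} (hφ : Rapid φ)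
    (k : ℕ) : ∑' x, ‖(f x : ℂ) * φ x‖ₑ * polyWeight k x.1 ≠ ∞ := by
  obtain ⟨C, hC, l, hf⟩ := hf
  refine ne_top_of_le_ne_top (ENNReal.mul_ne_top hC (hφ (l + k))) ?_
  rw [← ENNReal.tsum_mul_left]
  refine ENNReal.tsum_le_tsum fun x => ?_
  have hc : ‖(f x : ℂ)‖ₑ = ‖f x‖ₑ := by simp [← ofReal_norm]
  rw [enorm_mul, hc]
  calc _ ≤ C * polyWeight l x.1 * ‖φ x‖ₑ * polyWeight k x.1 := by gcongr; exact hf x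
    _ = _ := by rw [polyWeight, polyWeight, polyWeight, pow_add]; ring

theorem mulVec_apply {f : Site N → ℝ} (hf : PolyBdd f) {φ : Hdisc N} (hφ : Rapid φ) (x : Site N) :
    mulVec f φ x = f x * φ x := by
  have h := tsum_enorm_mul_ne_top hf hφ 0
  simp only [polyWeight, pow_zero, mul_one] at h
  rw [mulVec, dif_pos (memℓp_two_of_tsum_enorm_ne_top h)]

theorem rapid_mulVec {f : Site N → ℝ} (hf : PolyBdd f) {φ : Hdisc N} (hφ : Rapid φ) :
    Rapid (mulVec f φ) := by
  intro k
  simp only [mulVec_apply hf hφ]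
  exact tsum_enorm_mul_ne_top hf hφ k

theorem mulVec_graph {f : Site N → ℝ} (hf : PolyBdd f) {φ : Hdisc N} (hφ : Rapid φ) :
    (φ, mulVec f φ) ∈ (mulOp f).graph :=
  mem_mulOp_graph.2 (mulVec_apply hf hφ)

theorem IsLocalProj.kubo_graph {P : Hdisc N →L[ℂ] Hdisc N} (hP : IsLocalProj P) {f g : Site N → ℝ}
    (hf : PolyBdd f) (hg : PolyBdd g) {φ : Hdisc N} (hφ : Rapid φ) :
    (φ, Complex.I • (P (mulVec f (P (mulVec g (P φ)))) - P (mulVec g (P (mulVec f (P φ)))))) ∈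
      (kubo P (mulOp f) (mulOp g)).graph := by
  have h0 := hP.rapid_apply hφ
  have h1 := rapid_mulVec hf h0
  have h2 := rapid_mulVec hg h0
  refine SpinTransport.kubo_graph hP.mul_self (mulVec_graph hf h0) (mulVec_graph hg h0)
    (mulVec_graph hf (hP.rapid_apply h2)) (mulVec_graph hg (hP.rapid_apply h1))
    (mulVec_graph hf h2) ?_
  refine mem_mulOp_graph.2 fun x => ?_
  rw [mulVec_apply hf h2, mulVec_apply hg h0, mulVec_apply hf h0]
  ring

/-! ### Two-fold sums over the kernel of a projection -/

/-- `∑_{u,v} p(x,u) p(u,v) p(v,y) h(u,v)`. -/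
def pathSum (P : Hdisc N →L[ℂ] Hdisc N) (h : Site N → Site N → ℝ) (x y : Site N) : ℂ :=
  ∑' z : Site N × Site N, ent P x z.1 * ent P z.1 z.2 * ent P z.2 y * (h z.1 z.2 : ℝ)

section PathSum

variable {P : Hdisc N →L[ℂ] Hdisc N}

theorem IsLocalProj.tsum_col_ne_top (hP : IsLocalProj P) (k : ℕ) (y : Site N) :
    ∑' u, ‖ent P u y‖ₑ * polyWeight k u.1 ≠ ∞ := by
  have h := hP.rapid_apply (rapid_delta y) k
  simpa only [ent_eq] using h

theorem IsLocalProj.tsum_row_ne_top (hP : IsLocalProj P) (k : ℕ) (x : Site N) :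
    ∑' u, ‖ent P x u‖ₑ * polyWeight k u.1 ≠ ∞ := by
  have h := hP.tsum_col_ne_top k x
  have e : ∀ u, ‖ent P x u‖ₑ = ‖ent P u x‖ₑ := fun u => by
    rw [hP.symm x u, ← ofReal_norm, ← ofReal_norm, norm_star]
  simpa only [e] using h

/-- Bounding the middle entry by `‖P‖` alone decouples `u` from `v`; the decay of the two outer
entries suffices. -/
theorem enorm_pathSum_term_le {h : Site N → Site N → ℝ} {C : ℝ≥0∞} {k : ℕ}
    (hh : ∀ u v, ‖h u v‖ₑ ≤ C * (polyWeight k u.1 * polyWeight k v.1)) (x y : Site N)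
    (z : Site N × Site N) :
    ‖ent P x z.1 * ent P z.1 z.2 * ent P z.2 y * (h z.1 z.2 : ℝ)‖ₑ ≤
      ‖P‖ₑ * C * (‖ent P x z.1‖ₑ * polyWeight k z.1.1 * (‖ent P z.2 y‖ₑ * polyWeight k z.2.1)) := by
  have hc : ‖((h z.1 z.2 : ℝ) : ℂ)‖ₑ = ‖h z.1 z.2‖ₑ := by simp [← ofReal_norm]
  have hn : ‖ent P z.1 z.2‖ₑ ≤ ‖P‖ₑ := by
    rw [← ofReal_norm, ← ofReal_norm]
    exact ENNReal.ofReal_le_ofReal (norm_ent_le _ _ _)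
  rw [enorm_mul, enorm_mul, enorm_mul, hc]
  calc _ ≤ ‖ent P x z.1‖ₑ * ‖P‖ₑ * ‖ent P z.2 y‖ₑ *
        (C * (polyWeight k z.1.1 * polyWeight k z.2.1)) := by gcongr; exact hh _ _
    _ = _ := by ring

theorem IsLocalProj.tsum_dominating_ne_top (hP : IsLocalProj P) {C : ℝ≥0∞} (hC : C ≠ ∞) (k : ℕ)
    (x y : Site N) : ∑' z : Site N × Site N, ‖P‖ₑ * C *
      (‖ent P x z.1‖ₑ * polyWeight k z.1.1 * (‖ent P z.2 y‖ₑ * polyWeight k z.2.1)) ≠ ∞ := by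
  rw [ENNReal.tsum_mul_left, ENNReal.tsum_prod']
  simp only [ENNReal.tsum_mul_left, ENNReal.tsum_mul_right]
  exact ENNReal.mul_ne_top (ENNReal.mul_ne_top enorm_ne_top hC)
    (ENNReal.mul_ne_top (hP.tsum_row_ne_top k x) (hP.tsum_col_ne_top k y))

theorem IsLocalProj.tsum_enorm_pathSum_ne_top (hP : IsLocalProj P) {h : Site N → Site N → ℝ}
    (hh : PolyBdd₂ h) (x y : Site N) : ∑' z : Site N × Site N,
      ‖ent P x z.1 * ent P z.1 z.2 * ent P z.2 y * (h z.1 z.2 : ℝ)‖ₑ ≠ ∞ := by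
  obtain ⟨C, hC, k, hh⟩ := hh
  exact ne_top_of_le_ne_top (hP.tsum_dominating_ne_top hC k x y)
    (ENNReal.tsum_le_tsum (enorm_pathSum_term_le hh x y))

theorem IsLocalProj.summable_pathSum (hP : IsLocalProj P) {h : Site N → Site N → ℝ}
    (hh : PolyBdd₂ h) (x y : Site N) : Summable fun z : Site N × Site N =>
      ent P x z.1 * ent P z.1 z.2 * ent P z.2 y * (h z.1 z.2 : ℝ) :=
  summable_of_tsum_enorm_ne_top (hP.tsum_enorm_pathSum_ne_top hh x y)

theorem IsLocalProj.pathSum_sub (hP : IsLocalProj P) {h g : Site N → Site N → ℝ}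
    (hh : PolyBdd₂ h) (hg : PolyBdd₂ g) (x y : Site N) :
    pathSum P (fun u v => h u v - g u v) x y = pathSum P h x y - pathSum P g x y := by
  rw [pathSum, pathSum, pathSum,
    ← (hP.summable_pathSum hh x y).tsum_sub (hP.summable_pathSum hg x y)]
  refine tsum_congr fun z => ?_
  push_cast
  ring

theorem pathSum_const_mul (c : ℝ) (h : Site N → Site N → ℝ) (x y : Site N) :
    pathSum P (fun u v => c * h u v) x y = c * pathSum P h x y := by
  rw [pathSum, pathSum, ← tsum_mul_left]
  refine tsum_congr fun z => ?_
  push_cast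
  ring

/-- Idempotence sums out the free vertex and leaves the kernel of `P f P`. The same kernel arises in
`pathSum_snd`, so the two cancel in differences. -/
theorem IsLocalProj.pathSum_fst (hP : IsLocalProj P) {f : Site N → ℝ} (hf : PolyBdd f)
    (x y : Site N) : pathSum P (fun u _ => f u) x y = ∑' u, ent P x u * f u * ent P u y := by
  rw [pathSum, (hP.summable_pathSum (PolyBdd₂.fst hf) x y).tsum_prod]
  refine tsum_congr fun u => ?_
  have h : ent P u y = ∑' v, ent P u v * ent P v y := by rw [← ent_mul, hP.mul_self]
  rw [h, ← tsum_mul_left]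
  refine tsum_congr fun v => ?_
  ring

theorem IsLocalProj.pathSum_snd (hP : IsLocalProj P) {f : Site N → ℝ} (hf : PolyBdd f)
    (x y : Site N) : pathSum P (fun _ v => f v) x y = ∑' v, ent P x v * f v * ent P v y := by
  have hs := hP.summable_pathSum (PolyBdd₂.snd hf) x y
  rw [pathSum, ← (Equiv.prodComm (Site N) (Site N)).tsum_eq]
  rw [← (Equiv.prodComm (Site N) (Site N)).summable_iff] at hs
  refine (hs.tsum_prod).trans (tsum_congr fun v => ?_)
  have h : ent P x v = ∑' u, ent P x u * ent P u v := by rw [← ent_mul, hP.mul_self]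
  rw [h, ← tsum_mul_right, ← tsum_mul_right]
  refine tsum_congr fun u => ?_
  simp only [Function.comp_apply, Equiv.prodComm_apply, Prod.swap_prod_mk]
  ring

theorem IsLocalProj.pathSum_trans (hP : IsLocalProj P) (h : Site N → Site N → ℝ) (p : Lattice)
    (x y : Site N) : pathSum P h (trans p x) (trans p y) =
      pathSum P (fun u v => h (trans p u) (trans p v)) x y := by
  rw [pathSum, pathSum, ← ((trans p).prodCongr (trans p)).tsum_eq]
  refine tsum_congr fun z => ?_
  simp only [Equiv.prodCongr_apply, Prod.map_fst, Prod.map_snd, hP.periodic]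

/-- The antisymmetrised product `f(u) g(v) - g(u) f(v)`. -/
def wedge (f g : Site N → ℝ) (u v : Site N) : ℝ := f u * g v - g u * f v

theorem PolyBdd.wedge {f g : Site N → ℝ} (hf : PolyBdd f) (hg : PolyBdd g) :
    PolyBdd₂ (wedge f g) :=
  (PolyBdd₂.mul hf hg).sub (PolyBdd₂.mul hg hf)

/-- The change is `c (f(u) - f(v))`, whose path sum is `c (P f P - P f P) = 0`. -/
theorem IsLocalProj.pathSum_wedge_sub_const (hP : IsLocalProj P) {f g : Site N → ℝ}
    (hf : PolyBdd f) (hg : PolyBdd g) (c : ℝ) (x y : Site N) :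
    pathSum P (wedge f fun v => g v - c) x y = pathSum P (wedge f g) x y := by
  have e : wedge f (fun v => g v - c) = fun u v => wedge f g u v - c * (f u - f v) := by
    funext u v; simp only [wedge]; ring
  have hd : PolyBdd₂ fun u v => f u - f v := (PolyBdd₂.fst hf).sub (PolyBdd₂.snd hf)
  rw [e, hP.pathSum_sub (hf.wedge hg) (hd.const_mul c), pathSum_const_mul,
    hP.pathSum_sub (PolyBdd₂.fst hf) (PolyBdd₂.snd hf), hP.pathSum_fst hf, hP.pathSum_snd hf,
    sub_self, mul_zero, sub_zero]

theorem IsLocalProj.pathSum_mul (hP : IsLocalProj P) {f g : Site N → ℝ} (hf : PolyBdd f)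
    (hg : PolyBdd g) (x y : Site N) :
    P (mulVec f (P (mulVec g (P (delta y))))) x = pathSum P (fun u v => f u * g v) x y := by
  have h0 := hP.rapid_apply (rapid_delta y)
  have h1 := hP.rapid_apply (rapid_mulVec hg h0)
  rw [pathSum, (hP.summable_pathSum (PolyBdd₂.mul hf hg) x y).tsum_prod, apply_eq_tsum]
  refine tsum_congr fun u => ?_
  rw [mulVec_apply hf h1, apply_eq_tsum, ← tsum_mul_left, ← tsum_mul_left]
  refine tsum_congr fun v => ?_
  rw [mulVec_apply hg h0, ent_eq P v y]
  push_cast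
  ring

/-- The vector `i P [[P, f], [P, g]] P δ_y`. -/
def kuboVec (P : Hdisc N →L[ℂ] Hdisc N) (f g : Site N → ℝ) (y : Site N) : Hdisc N :=
  Complex.I • (P (mulVec f (P (mulVec g (P (delta y))))) -
    P (mulVec g (P (mulVec f (P (delta y))))))

theorem IsLocalProj.kuboVec_graph (hP : IsLocalProj P) {f g : Site N → ℝ} (hf : PolyBdd f)
    (hg : PolyBdd g) (y : Site N) :
    (delta y, kuboVec P f g y) ∈ (kubo P (mulOp f) (mulOp g)).graph :=
  hP.kubo_graph hf hg (rapid_delta y)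

theorem IsLocalProj.kuboVec_apply (hP : IsLocalProj P) {f g : Site N → ℝ} (hf : PolyBdd f)
    (hg : PolyBdd g) (x y : Site N) :
    kuboVec P f g y x = Complex.I * pathSum P (wedge f g) x y := by
  have e : wedge f g = fun u v => f u * g v - g u * f v := rfl
  rw [e, hP.pathSum_sub (PolyBdd₂.mul hf hg) (PolyBdd₂.mul hg hf), ← hP.pathSum_mul hf hg,
    ← hP.pathSum_mul hg hf]
  rfl

end PathSum

/-! ### The trace per unit cell -/

section CellTrace

variable {P : Hdisc N →L[ℂ] Hdisc N}

/-- `∑_i ∑_{u,v} p(x,u) p(u,v) p(v,x) h(u,v)` with `x = (0, i)`. -/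
def cellTrace (P : Hdisc N →L[ℂ] Hdisc N) (h : Internal N → Site N → Site N → ℝ) : ℂ :=
  ∑ i, pathSum P (h i) (0, i) (0, i)

theorem IsLocalProj.cellTrace_eq_tsum (hP : IsLocalProj P) {h : Internal N → Site N → Site N → ℝ}
    (hh : ∀ i, PolyBdd₂ (h i)) : cellTrace P h = ∑' w : Internal N × Site N × Site N,
      ent P (0, w.1) w.2.1 * ent P w.2.1 w.2.2 * ent P w.2.2 (0, w.1) * (h w.1 w.2.1 w.2.2 : ℝ) := by
  rw [Summable.tsum_prod, tsum_fintype]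
  · rfl
  · refine summable_of_tsum_enorm_ne_top ?_
    rw [ENNReal.tsum_prod', tsum_fintype]
    refine ENNReal.sum_ne_top.2 fun i _ => ?_
    have h := hP.tsum_enorm_pathSum_ne_top (hh i) (0, i) (0, i)
    exact h

/-- The cyclic relabelling of closed paths of length three modulo translations. -/
def rotEquiv (N : ℕ) : Internal N × Site N × Site N ≃ Internal N × Site N × Site N where
  toFun w := (w.2.1.2, (w.2.2.1 - w.2.1.1, w.2.2.2), (-w.2.1.1, w.1))
  invFun w := (w.2.2.2, (-w.2.2.1, w.1), (w.2.1.1 - w.2.2.1, w.2.1.2))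
  left_inv w := by simp
  right_inv w := by simp

/-- Cyclicity of the trace per cell: the path `x → u → v → x` may be based at another of its
vertices and translated back to the origin. This requires `g` to be invariant under translations. -/
theorem IsLocalProj.cellTrace_rot (hP : IsLocalProj P) {g : Site N → Site N → Site N → ℝ}
    (hg : ∀ p x u v, g (trans p x) (trans p u) (trans p v) = g x u v)
    (h1 : ∀ i, PolyBdd₂ (g (0, i))) (h2 : ∀ i, PolyBdd₂ fun u v => g u v (0, i)) :
    cellTrace P (fun i => g (0, i)) = cellTrace P (fun i u v => g u v (0, i)) := by
  rw [hP.cellTrace_eq_tsum h1, hP.cellTrace_eq_tsum (h := fun i u v => g u v (0, i)) h2,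
    ← (rotEquiv N).tsum_eq]
  refine tsum_congr fun w => ?_
  obtain ⟨i, ⟨n, j⟩, ⟨m, k⟩⟩ := w
  have a1 : trans (-n) ((n, j) : Site N) = (0, j) := by simp
  have a2 : trans (-n) ((m, k) : Site N) = (m - n, k) := by simp [sub_eq_add_neg]
  have a3 : trans (-n) ((0, i) : Site N) = (-n, i) := by simp
  simp only [rotEquiv, Equiv.coe_fn_mk]
  rw [← a1, ← a2, ← a3, hP.periodic, hP.periodic, hP.periodic, hg]
  ring

/-- The spin of a site. -/
def spin (x : Site N) : ℝ := if x.2.2 = 0 then 1 / 2 else -(1 / 2)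

@[simp]
theorem spin_trans (p : Lattice) (x : Site N) : spin (trans p x) = spin x := rfl

theorem abs_spin (x : Site N) : |spin x| = 1 / 2 := by
  rw [spin]
  split_ifs <;> norm_num [abs_of_pos]

theorem PolyBdd.spin : PolyBdd (spin : Site N → ℝ) := .of_bounded fun x => (abs_spin x).le

/-- The spin torque response has vanishing trace per unit cell. -/
theorem IsLocalProj.cellTrace_torque (hP : IsLocalProj P) (j : Fin 2) :
    cellTrace P (fun _ => wedge spin fun v => (v.1 j : ℝ)) = 0 := by
  have hc : PolyBdd fun x : Site N => (x.1 j : ℝ) := .coord j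
  have hs : PolyBdd (spin : Site N → ℝ) := .spin
  have b1 : PolyBdd₂ fun u v : Site N => spin u * (v.1 j : ℝ) := .mul hs hc
  have b2 : PolyBdd₂ fun u v : Site N => (u.1 j : ℝ) * spin v := .mul hc hs
  have b3 : PolyBdd₂ fun u v : Site N => (u.1 j : ℝ) - (v.1 j : ℝ) :=
    (PolyBdd₂.fst hc).sub (PolyBdd₂.snd hc)
  have b3' : PolyBdd₂ fun u v : Site N => (v.1 j : ℝ) - (u.1 j : ℝ) :=
    (PolyBdd₂.snd hc).sub (PolyBdd₂.fst hc)
  -- At the base point the coordinate is zero, so `v_j` equals the translation invariant `v_j -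
  -- x_j`. Two rotations bring the spin to the base point.
  have hA : cellTrace P (fun _ u v => spin u * (v.1 j : ℝ)) =
      cellTrace P (fun i u v => spin ((0, i) : Site N) * ((u.1 j : ℝ) - v.1 j)) := by
    have e1 := hP.cellTrace_rot (g := fun x u v => spin u * ((v.1 j : ℝ) - x.1 j))
      (by intros; simp) (fun i => by simpa using b1)
      (fun i => by simpa [mul_comm] using b2.const_mul (-1))
    have e2 := hP.cellTrace_rot (g := fun x u v => spin v * ((x.1 j : ℝ) - u.1 j))
      (by intros; simp) (fun i => by simpa [mul_comm] using b2.const_mul (-1))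
      (fun i => b3.const_mul _)
    simpa using e1.trans e2
  have hB : cellTrace P (fun _ u v => (u.1 j : ℝ) * spin v) =
      cellTrace P (fun i u v => spin ((0, i) : Site N) * ((v.1 j : ℝ) - u.1 j)) := by
    have e1 := hP.cellTrace_rot (g := fun x u v => spin v * ((u.1 j : ℝ) - x.1 j))
      (by intros; simp) (fun i => by simpa [mul_comm] using b2)
      (fun i => b3'.const_mul _)
    simpa [mul_comm] using e1
  -- With the spin constant along the sum, what remains is a diagonal entry of `P X_j P - P X_j P`.
  have h0 : ∀ i : Internal N, pathSum P (fun u v => (u.1 j : ℝ) - v.1 j) (0, i) (0, i) = 0 := by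
    intro i
    rw [hP.pathSum_sub (PolyBdd₂.fst hc) (PolyBdd₂.snd hc), hP.pathSum_fst hc, hP.pathSum_snd hc,
      sub_self]
  have h0' : ∀ i : Internal N, pathSum P (fun u v => (v.1 j : ℝ) - u.1 j) (0, i) (0, i) = 0 := by
    intro i
    rw [hP.pathSum_sub (PolyBdd₂.snd hc) (PolyBdd₂.fst hc), hP.pathSum_fst hc, hP.pathSum_snd hc,
      sub_self]
  have e : cellTrace P (fun _ => wedge spin fun v => (v.1 j : ℝ)) =
      cellTrace P (fun _ u v => spin u * (v.1 j : ℝ)) -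
        cellTrace P (fun _ u v => (u.1 j : ℝ) * spin v) := by
    rw [cellTrace, cellTrace, cellTrace, ← Finset.sum_sub_distrib]
    exact Finset.sum_congr rfl fun i _ => hP.pathSum_sub b1 b2 _ _
  rw [e, hA, hB]
  simp only [cellTrace, pathSum_const_mul, h0, h0', mul_zero, Finset.sum_const_zero, sub_self]

end CellTrace

/-! ### Switch functions of one variable -/

/-- A function on `ℤ` with values in `[0, 1]`, equal to `0` below `a` and to `1` from `b` on. -/
structure IsStep (l : ℤ → ℝ) (a b : ℤ) : Prop where
  nonneg : ∀ n, 0 ≤ l n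
  le_one : ∀ n, l n ≤ 1
  lt : a < b
  eq_zero : ∀ n, n < a → l n = 0
  eq_one : ∀ n, b ≤ n → l n = 1

theorem IsSwitch.exists_isStep {j : Fin 2} {Λ : Lattice → ℝ} (h : IsSwitch j Λ) :
    ∃ l a b, IsStep l a b ∧ ∀ n, Λ n = l (n j) := by
  obtain ⟨h01, hdep, a, b, hab, h0, h1⟩ := h
  refine ⟨fun n => Λ fun _ => n, a, b, ⟨fun n => (h01 _).1, fun n => (h01 _).2, hab,
    fun n hn => h0 _ hn, fun n hn => h1 _ hn⟩, fun n => hdep _ _ rfl⟩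

section IsStep

variable {l : ℤ → ℝ} {a b : ℤ}

theorem IsStep.abs_sub_le (h : IsStep l a b) (m n : ℤ) : |l m - l n| ≤ 1 := by
  rw [abs_le]
  constructor <;> linarith [h.nonneg m, h.nonneg n, h.le_one m, h.le_one n]

/-- The differences are at most `1` and live on a window of `|v| + (b - a)` integers. The bound is
uniform in `s` and provides the domination needed later. -/
theorem IsStep.sum_abs_sub_le (h : IsStep l a b) (v : ℤ) (s : Finset ℤ) :
    ∑ n ∈ s, |l (v + n) - l n| ≤ |(v : ℝ)| + (b - a) := by
  set S := Finset.Ico (min a (a - v)) (max b (b - v)) with hS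
  have hzero : ∀ n, n ∉ S → l (v + n) - l n = 0 := by
    intro n hn
    rw [hS, Finset.mem_Ico, not_and_or, not_le, not_lt, lt_min_iff, max_le_iff] at hn
    rcases hn with hn | hn
    · rw [h.eq_zero _ hn.1, h.eq_zero (v + n) (by omega), sub_zero]
    · rw [h.eq_one _ hn.1, h.eq_one (v + n) (by omega), sub_self]
  have hab := h.lt
  have hcard : (S.card : ℝ) = |(v : ℝ)| + (b - a) := by
    have : (S.card : ℤ) = |v| + (b - a) := by
      rw [hS, Int.card_Ico, Int.toNat_of_nonneg (by omega)]
      rcases le_total 0 v with hv | hv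
      · rw [abs_of_nonneg hv]; omega
      · rw [abs_of_nonpos hv]; omega
    exact_mod_cast this
  calc ∑ n ∈ s, |l (v + n) - l n| = ∑ n ∈ s ∩ S, |l (v + n) - l n| := by
        refine (Finset.sum_subset Finset.inter_subset_left fun n hn hn' => ?_).symm
        rw [hzero n fun hS => hn' (Finset.mem_inter.2 ⟨hn, hS⟩), abs_zero]
    _ ≤ ∑ n ∈ s ∩ S, (1 : ℝ) := Finset.sum_le_sum fun n _ => h.abs_sub_le _ _
    _ = ((s ∩ S).card : ℝ) := by simp
    _ ≤ (S.card : ℝ) := by exact_mod_cast Finset.card_le_card Finset.inter_subset_right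
    _ = _ := hcard

theorem IsStep.tsum_enorm_sub_le (h : IsStep l a b) (v : ℤ) :
    ∑' n, ‖l (v + n) - l n‖ₑ ≤ ENNReal.ofReal (|(v : ℝ)| + (b - a)) := by
  rw [ENNReal.tsum_eq_iSup_sum]
  refine iSup_le fun s => ?_
  simp only [← ofReal_norm, Real.norm_eq_abs]
  rw [← ENNReal.ofReal_sum_of_nonneg fun _ _ => abs_nonneg _]
  exact ENNReal.ofReal_le_ofReal (h.sum_abs_sub_le v s)

theorem IsStep.hasSum_sub_one (h : IsStep l a b) : HasSum (fun n => l (1 + n) - l n) 1 := by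
  -- The `m` consecutive points start at `a - 1` and end at `b - 1`; the telescoped sum is `l b - l
  -- (a - 1) = 1`.
  set m : ℕ := (b - a + 1).toNat with hm
  have hab := h.lt
  let e : ℕ ↪ ℤ := ⟨fun k => a - 1 + k, fun k k' hk => by simpa using hk⟩
  have he : ∀ k : ℕ, e k = a - 1 + k := fun k => rfl
  have hsum : ∑ n ∈ (Finset.range m).map e, (l (1 + n) - l n) = 1 := by
    rw [Finset.sum_map]
    have e1 : ∀ k : ℕ, l (1 + e k) - l (e k) = l (a - 1 + (k + 1 : ℕ)) - l (a - 1 + k) := by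
      intro k
      rw [he]
      congr 2
      push_cast
      ring
    rw [Finset.sum_congr rfl fun k _ => e1 k,
      Finset.sum_range_sub fun k : ℕ => l (a - 1 + k)]
    rw [h.eq_one _ (by omega), h.eq_zero _ (by push_cast; omega), sub_zero]
  rw [← hsum]
  refine hasSum_sum_of_ne_finset_zero fun n hn => ?_
  by_cases h1 : n < a - 1
  · rw [h.eq_zero _ (by omega), h.eq_zero n (by omega), sub_zero]
  · have h2 : b ≤ n := by
      by_contra h3
      refine hn (Finset.mem_map.2 ⟨(n - (a - 1)).toNat, Finset.mem_range.2 (by omega), ?_⟩)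
      rw [he]
      omega
    rw [h.eq_one _ (by omega), h.eq_one n h2, sub_self]

/-- Summing over translates replaces any switch by the coordinate `v`, forgetting its profile. This
is why the conductance does not depend on the switch functions. -/
theorem IsStep.hasSum_sub (h : IsStep l a b) (v : ℤ) :
    HasSum (fun n => l (v + n) - l n) (v : ℝ) := by
  induction v using Int.induction_on with
  | zero => simp
  | succ v ih =>
    have h1 := ((Equiv.addLeft (v : ℤ)).hasSum_iff.2 h.hasSum_sub_one).add ih
    push_cast at h1 ⊢
    rw [add_comm (v : ℝ)]
    refine h1.congr_fun fun n => ?_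
    simp only [Function.comp_apply, Equiv.coe_addLeft]
    rw [show 1 + ((v : ℤ) + n) = v + 1 + n by ring]
    ring
  | pred v ih =>
    have h1 := ih.sub ((Equiv.addLeft (-(v : ℤ) - 1)).hasSum_iff.2 h.hasSum_sub_one)
    push_cast at h1 ⊢
    refine h1.congr_fun fun n => ?_
    simp only [Function.comp_apply, Equiv.coe_addLeft]
    rw [show 1 + (-(v : ℤ) - 1 + n) = -v + n by ring]
    ring

theorem IsStep.polyBdd (h : IsStep l a b) (j : Fin 2) (n : ℤ) :
    PolyBdd fun x : Site N => l (x.1 j + n) :=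
  .of_bounded (C := 1) fun x => by rw [abs_of_nonneg (h.nonneg _)]; exact h.le_one _

theorem IsStep.polyBdd_sub (h : IsStep l a b) (j : Fin 2) (n : ℤ) :
    PolyBdd fun x : Site N => l (x.1 j + n) - l n :=
  .of_bounded (C := 1) fun _ => h.abs_sub_le _ _

end IsStep

/-! ### Summation of path sums over translates -/

theorem PolyBdd.abs {f : Site N → ℝ} (hf : PolyBdd f) : PolyBdd fun x => |f x| := by
  obtain ⟨C, hC, k, hf⟩ := hf
  refine ⟨C, hC, k, fun x => ?_⟩
  rw [← ofReal_norm, Real.norm_eq_abs, abs_abs, ← Real.norm_eq_abs, ofReal_norm]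
  exact hf x

section Dominated

variable {P : Hdisc N →L[ℂ] Hdisc N}

theorem IsLocalProj.tendsto_pathSum (hP : IsLocalProj P) {ι : Type*} {F : Filter ι}
    {h : ι → Site N → Site N → ℝ} {h' H : Site N → Site N → ℝ} (hH : PolyBdd₂ H)
    (hb : ∀ i u v, |h i u v| ≤ H u v)
    (hl : ∀ u v, Filter.Tendsto (fun i => h i u v) F (nhds (h' u v))) (x y : Site N) :
    Filter.Tendsto (fun i => pathSum P (h i) x y) F (nhds (pathSum P h' x y)) := by
  refine tendsto_tsum_of_dominated_convergence (hP.summable_pathSum hH x y).norm (fun z => ?_)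
    (Filter.Eventually.of_forall fun i z => ?_)
  · refine Filter.Tendsto.const_mul _ ?_
    exact (Complex.continuous_ofReal.tendsto _).comp (hl z.1 z.2)
  · rw [norm_mul, norm_mul _ ((H z.1 z.2 : ℝ) : ℂ), Complex.norm_real, Complex.norm_real]
    gcongr
    exact (hb i z.1 z.2).trans (le_abs_self _)

theorem IsLocalProj.pathSum_wedge_sum (hP : IsLocalProj P) {ι : Type*} (s : Finset ι)
    {f : Site N → ℝ} {g : ι → Site N → ℝ} (hf : PolyBdd f) (hg : ∀ i, PolyBdd (g i))
    (x y : Site N) : ∑ i ∈ s, pathSum P (wedge f (g i)) x y =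
      pathSum P (wedge f fun v => ∑ i ∈ s, g i v) x y := by
  simp only [pathSum]
  rw [← Summable.tsum_finsetSum fun i _ => hP.summable_pathSum (hf.wedge (hg i)) x y]
  refine tsum_congr fun z => ?_
  rw [← Finset.mul_sum]
  simp only [wedge]
  push_cast
  rw [Finset.sum_sub_distrib, Finset.mul_sum, Finset.sum_mul]

theorem pathSum_wedge_swap (f g : Site N → ℝ) (x y : Site N) :
    pathSum P (wedge f g) x y = -pathSum P (wedge g f) x y := by
  rw [pathSum, pathSum, ← tsum_neg]
  refine tsum_congr fun z => ?_
  simp only [wedge]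
  push_cast
  ring

/-- Dominated convergence: partial sums of `IsStep.hasSum_sub` grow at most linearly in `v`, and the
kernel of `P` has finite moments. -/
theorem IsLocalProj.hasSum_pathSum_wedge (hP : IsLocalProj P) {l : ℤ → ℝ} {a b : ℤ}
    (hl : IsStep l a b) (j : Fin 2) {f s : Site N → ℝ} (hf : PolyBdd f) (hs : PolyBdd s)
    (x y : Site N) :
    HasSum (fun n => pathSum P (wedge f fun v => (l (v.1 j + n) - l n) * s v) x y)
      (pathSum P (wedge f fun v => (v.1 j : ℝ) * s v) x y) := by
  have hg : ∀ n, PolyBdd fun v : Site N => (l (v.1 j + n) - l n) * s v :=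
    fun n => (hl.polyBdd_sub j n).mul hs
  have hab : (0 : ℝ) ≤ b - a := by
    have := hl.lt
    have : (a : ℝ) < b := by exact_mod_cast this
    linarith
  have hG : PolyBdd fun v : Site N => (|(v.1 j : ℝ)| + (b - a)) * |s v| := by
    refine PolyBdd.mul (PolyBdd.of_affine (C := 1 + (b - a)) (by linarith) fun v => ?_) hs.abs
    have h := norm_le_pi_norm v.1 j
    rw [Int.norm_eq_abs] at h
    rw [abs_of_nonneg (by positivity)]
    nlinarith [norm_nonneg v.1]
  -- The sum of two dominating terms, written as a difference to match `PolyBdd₂.sub`.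
  have hH : PolyBdd₂ fun u v : Site N => |f u| * ((|(v.1 j : ℝ)| + (b - a)) * |s v|) -
      (-1) * (((|(u.1 j : ℝ)| + (b - a)) * |s u|) * |f v|) :=
    (PolyBdd₂.mul hf.abs hG).sub ((PolyBdd₂.mul hG hf.abs).const_mul _)
  unfold HasSum
  simp only [SummationFilter.unconditional_filter, hP.pathSum_wedge_sum _ hf hg]
  have hb : ∀ (F : Finset ℤ) (v : Site N), |∑ n ∈ F, (l (v.1 j + n) - l n) * s v| ≤
      (|(v.1 j : ℝ)| + (b - a)) * |s v| := by
    intro F v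
    rw [← Finset.sum_mul, abs_mul]
    gcongr
    exact (Finset.abs_sum_le_sum_abs _ _).trans (hl.sum_abs_sub_le _ _)
  have hlim : ∀ v : Site N, Filter.Tendsto (fun F : Finset ℤ => ∑ n ∈ F, (l (v.1 j + n) - l n) * s v)
      Filter.atTop (nhds ((v.1 j : ℝ) * s v)) := fun v => (hl.hasSum_sub (v.1 j)).mul_right (s v)
  refine hP.tendsto_pathSum hH (fun F u v => ?_) (fun u v => ?_) x y
  · simp only [wedge]
    refine (abs_sub _ _).trans ?_
    rw [abs_mul, abs_mul, neg_one_mul, sub_neg_eq_add]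
    gcongr
    · exact hb F v
    · exact hb F u
  · exact ((hlim v).const_mul _).sub ((hlim u).mul_const _)

end Dominated

/-! ### Multiplication by bounded functions -/

/-- Multiplication by a function bounded by `1`. -/
def diagOp (f : Site N → ℝ) (hf : ∀ x, |f x| ≤ 1) : Hdisc N →L[ℂ] Hdisc N :=
  have h : ∀ (φ : Hdisc N) x, ‖(f x : ℂ) * φ x‖ ≤ ‖φ x‖ := fun φ x => by
    rw [norm_mul, Complex.norm_real]
    exact mul_le_of_le_one_left (norm_nonneg _) (hf x)
  LinearMap.mkContinuous
    { toFun := fun φ => ⟨fun x => (f x : ℂ) * φ x, (lp.memℓp φ).mono' (h φ)⟩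
      map_add' := fun φ ψ => Subtype.ext (funext fun x => mul_add _ _ _)
      map_smul' := fun c φ => Subtype.ext (funext fun x => by simp [mul_left_comm]) } 1
    fun φ => by
      rw [one_mul]
      exact lp.norm_mono (by norm_num) (h φ)

section DiagOp

variable {f : Site N → ℝ} (hf : ∀ x, |f x| ≤ 1)

theorem diagOp_apply (φ : Hdisc N) (x : Site N) : diagOp f hf φ x = f x * φ x := rfl

theorem diagOp_graph (φ : Hdisc N) : (φ, diagOp f hf φ) ∈ (mulOp f).graph :=
  mem_mulOp_graph.2 fun _ => rfl

theorem norm_diagOp_apply_le (φ : Hdisc N) : ‖diagOp f hf φ‖ ≤ ‖φ‖ := by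
  refine lp.norm_mono (by norm_num) fun x => ?_
  rw [diagOp_apply, norm_mul, Complex.norm_real]
  exact mul_le_of_le_one_left (norm_nonneg _) (hf x)

theorem diagOp_delta (y : Site N) : diagOp f hf (delta y) = (f y : ℂ) • (delta y : Hdisc N) := by
  apply lp.ext
  funext x
  rw [diagOp_apply, lp.coeFn_smul, Pi.smul_apply, smul_eq_mul, delta_apply]
  split_ifs with h
  · rw [h]
  · simp

end DiagOp

/-- The bounded operator `i P [[P, f], [P, g]] P` for an orthogonal projection `P` and
multiplication operators `f`, `g`. -/
def kuboBounded (P A B : Hdisc N →L[ℂ] Hdisc N) : Hdisc N →L[ℂ] Hdisc N :=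
  Complex.I • (P * A * P * B * P - P * B * P * A * P)

section Conductance

variable {P : Hdisc N →L[ℂ] Hdisc N} {f g : Site N → ℝ}

theorem IsLocalProj.kuboBounded_graph (hP : IsLocalProj P) (hf : ∀ x, |f x| ≤ 1)
    (hg : ∀ x, |g x| ≤ 1) (φ : Hdisc N) :
    (φ, kuboBounded P (diagOp f hf) (diagOp g hg) φ) ∈ (kubo P (mulOp f) (mulOp g)).graph := by
  refine SpinTransport.kubo_graph hP.mul_self (diagOp_graph hf _) (diagOp_graph hg _)
    (diagOp_graph hf _) (diagOp_graph hg _) (diagOp_graph hf _) ?_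
  refine mem_mulOp_graph.2 fun x => ?_
  simp only [diagOp_apply]
  ring

theorem IsLocalProj.ent_kuboBounded (hP : IsLocalProj P) (hf : ∀ x, |f x| ≤ 1)
    (hg : ∀ x, |g x| ≤ 1) (x y : Site N) :
    ent (kuboBounded P (diagOp f hf) (diagOp g hg)) x y =
      Complex.I * pathSum P (wedge f g) x y := by
  have hf' : PolyBdd f := .of_bounded hf
  have hg' : PolyBdd g := .of_bounded hg
  have h : kuboBounded P (diagOp f hf) (diagOp g hg) (delta y) = kuboVec P f g y :=
    LinearPMap.mem_graph_snd_inj _ (hP.kuboBounded_graph hf hg _) (hP.kuboVec_graph hf' hg' y) rfl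
  rw [ent_eq, h, hP.kuboVec_apply hf' hg']

theorem enorm_apply_le_kernel (A B : Hdisc N →L[ℂ] Hdisc N) (hf : ∀ x, |f x| ≤ 1) (u y : Site N) :
    ‖A (diagOp f hf (B (delta y))) u‖ₑ ≤ kcomp (absEnt A) (absEnt B) u y := by
  rw [apply_eq_tsum]
  refine enorm_tsum_le_tsum_enorm.trans (ENNReal.tsum_le_tsum fun v => ?_)
  rw [diagOp_apply, enorm_mul, enorm_mul, ← ent_eq]
  have h1 : ‖(f v : ℂ)‖ₑ ≤ 1 := by
    rw [← ofReal_norm, Complex.norm_real, ← ENNReal.ofReal_one]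
    exact ENNReal.ofReal_le_ofReal (hf v)
  calc _ ≤ ‖ent A u v‖ₑ * (1 * ‖ent B v y‖ₑ) := by gcongr
    _ = _ := by rw [one_mul]; rfl

theorem enorm_diagOp_sub_smul_le (hg : ∀ x, |g x| ≤ 1) (c : ℝ) (φ : Hdisc N) :
    ‖diagOp g hg φ - (c : ℂ) • φ‖ₑ ≤ ∑' u, ‖g u - c‖ₑ * ‖φ u‖ₑ := by
  refine (norm_le_tsum_enorm _).trans (le_of_eq (tsum_congr fun u => ?_))
  have e : (diagOp g hg φ - (c : ℂ) • φ) u = ((g u - c : ℝ) : ℂ) * φ u := by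
    rw [lp.coeFn_sub, Pi.sub_apply, diagOp_apply, lp.coeFn_smul, Pi.smul_apply, smul_eq_mul]
    push_cast
    ring
  rw [e, enorm_mul]
  congr 1
  rw [← ofReal_norm, ← ofReal_norm, Complex.norm_real]

/-- The columns of `i P [[P, f], [P, g]] P` are small where `g` is locally constant. -/
theorem IsLocalProj.enorm_kuboBounded_delta_le (hP : IsLocalProj P) (hf : ∀ x, |f x| ≤ 1)
    (hg : ∀ x, |g x| ≤ 1) (y : Site N) :
    ‖kuboBounded P (diagOp f hf) (diagOp g hg) (delta y)‖ₑ ≤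
      ‖P * diagOp f hf * P‖ₑ * ∑' u, ‖g u - g y‖ₑ * absEnt P u y +
        ‖P‖ₑ * ∑' u, ‖g u - g y‖ₑ * kcomp (absEnt P) (absEnt P) u y := by
  have hPP : ∀ ψ, P (P ψ) = P ψ := fun ψ => by rw [← mul_apply_eq_comp, hP.mul_self]
  set A := diagOp f hf
  set B := diagOp g hg
  set c : ℂ := ((g y : ℝ) : ℂ)
  set φ := P (delta y) with hφ
  -- Both subtracted terms equal `c • P A P φ`, so they cancel, and `B` may be replaced by `B - c`
  -- in each half.
  have e : kuboBounded P A B (delta y) =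
      Complex.I • ((P * A * P) (B φ - c • φ) - P (B (P (A φ)) - c • P (A φ))) := by
    simp only [kuboBounded, _root_.smul_apply, _root_.sub_apply,
      mul_apply_eq_comp, map_sub, map_smul, hPP, ← hφ]
    congr 1
    rw [show P φ = φ from hPP _]
    abel
  have hop : ∀ (T : Hdisc N →L[ℂ] Hdisc N) ψ, ‖T ψ‖ₑ ≤ ‖T‖ₑ * ‖ψ‖ₑ := fun T ψ => by
    rw [← ofReal_norm, ← ofReal_norm, ← ofReal_norm, ← ENNReal.ofReal_mul (norm_nonneg _)]
    exact ENNReal.ofReal_le_ofReal (T.le_opNorm ψ)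
  rw [e, enorm_smul]
  have hI : ‖Complex.I‖ₑ = 1 := by rw [← ofReal_norm]; simp
  rw [hI, one_mul]
  refine enorm_sub_le.trans (add_le_add ((hop _ _).trans ?_) ((hop _ _).trans ?_))
  · gcongr
    refine (enorm_diagOp_sub_smul_le hg (g y) φ).trans (le_of_eq (tsum_congr fun u => ?_))
    rw [hφ, ← ent_eq]; rfl
  · gcongr
    refine (enorm_diagOp_sub_smul_le hg (g y) _).trans (ENNReal.tsum_le_tsum fun u => ?_)
    gcongr
    exact enorm_apply_le_kernel P P hf u y

theorem tsum_lattice_mul (F G : ℤ → ℝ≥0∞) :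
    ∑' n : Lattice, F (n 0) * G (n 1) = (∑' n, F n) * ∑' n, G n := by
  rw [← (finTwoArrowEquiv ℤ).symm.tsum_eq, ENNReal.tsum_prod']
  simp [ENNReal.tsum_mul_left, ENNReal.tsum_mul_right]

/-- After translating `y` to the origin, `|l(v₁ + n₁) - l(n₁)|` sums over `n₁` to at most `|v₁| + (b
- a)`, which the first moment of `r` absorbs. Direction `0` is restricted to the finite set `s`. -/
theorem tsum_stripe_ne_top {r : Site N → Site N → ℝ≥0∞}
    (hr : ∀ p x y, r (trans p x) (trans p y) = r x y) (hw : colNorm (polyWeight 1) r ≠ ∞)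
    {l : ℤ → ℝ} {a b : ℤ} (hl : IsStep l a b) (s : Finset ℤ) :
    ∑' y : Site N, (s : Set ℤ).indicator (fun _ => (1 : ℝ≥0∞)) (y.1 0) *
      ∑' u : Site N, ‖l (u.1 1) - l (y.1 1)‖ₑ * r u y ≠ ∞ := by
  set χ : ℤ → ℝ≥0∞ := (s : Set ℤ).indicator fun _ => 1 with hχ
  have hχs : ∑' n, χ n = s.card := by
    rw [tsum_eq_sum (s := s) fun n hn => by simp [hχ, hn]]
    simp [hχ, Set.indicator_apply, Finset.sum_ite_mem]
  have hab : (0 : ℝ) ≤ b - a := by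
    have : (a : ℝ) < b := by exact_mod_cast hl.lt
    linarith
  set K : ℝ≥0∞ := ENNReal.ofReal (1 + (b - a)) with hK
  have hbound : ∀ v : Lattice, ∑' n : Lattice, χ (n 0) * ‖l (v 1 + n 1) - l (n 1)‖ₑ ≤
      s.card * (K * polyWeight 1 v) := by
    intro v
    rw [tsum_lattice_mul χ fun n => ‖l (v 1 + n) - l n‖ₑ, hχs]
    gcongr
    refine (hl.tsum_enorm_sub_le (v 1)).trans ?_
    rw [polyWeight, pow_one, ← ofReal_norm, ← ENNReal.ofReal_one,
      ← ENNReal.ofReal_add zero_le_one (norm_nonneg _), ← ENNReal.ofReal_mul (by linarith)]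
    refine ENNReal.ofReal_le_ofReal ?_
    have h := norm_le_pi_norm v 1
    rw [Int.norm_eq_abs] at h
    nlinarith [norm_nonneg v]
  have hle : ∑' y : Site N, χ (y.1 0) * ∑' u : Site N, ‖l (u.1 1) - l (y.1 1)‖ₑ * r u y ≤
      ∑' _ : Internal N, s.card * K * colNorm (polyWeight 1) r := by
    rw [← (Equiv.prodComm (Internal N) Lattice).tsum_eq, ENNReal.tsum_prod']
    refine ENNReal.tsum_le_tsum fun i => ?_
    have e : ∀ n : Lattice, χ (n 0) * ∑' u : Site N, ‖l (u.1 1) - l (n 1)‖ₑ * r u (n, i) =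
        ∑' u : Site N, χ (n 0) * ‖l (u.1 1 + n 1) - l (n 1)‖ₑ * r u (0, i) := by
      intro n
      rw [← (trans n).tsum_eq, ← ENNReal.tsum_mul_left]
      refine tsum_congr fun u => ?_
      have := hr n u (0, i)
      rw [trans_apply n 0, zero_add] at this
      rw [this, mul_assoc]
      rfl
    simp only [Equiv.prodComm_apply, Prod.swap_prod_mk, e]
    rw [ENNReal.tsum_comm]
    simp only [ENNReal.tsum_mul_right]
    calc _ ≤ ∑' u : Site N, s.card * (K * polyWeight 1 u.1) * r u (0, i) := by
          refine ENNReal.tsum_le_tsum fun u => ?_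
          gcongr
          exact hbound u.1
      _ = s.card * K * ∑' u : Site N, r u (0, i) * polyWeight 1 (u.1 - 0) := by
          rw [← ENNReal.tsum_mul_left]
          refine tsum_congr fun u => ?_
          rw [sub_zero]
          ring
      _ ≤ _ := by
          gcongr
          exact tsum_le_colNorm r (0, i)
  refine ne_top_of_le_ne_top ?_ hle
  rw [tsum_fintype]
  exact ENNReal.sum_ne_top.2 fun _ _ => ENNReal.mul_ne_top
    (ENNReal.mul_ne_top (ENNReal.natCast_ne_top _) ENNReal.ofReal_ne_top) hw

theorem IsLocalProj.summable_stripe (hP : IsLocalProj P) (hf : ∀ x, |f x| ≤ 1) {l : ℤ → ℝ}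
    {a b : ℤ} (hl : IsStep l a b) (hg : ∀ x : Site N, |l (x.1 1)| ≤ 1) (s : Finset ℤ) :
    Summable fun y : Site N => (s : Set ℤ).indicator (fun _ => (1 : ℝ)) (y.1 0) *
      ‖kuboBounded P (diagOp f hf) (diagOp (fun x => l (x.1 1)) hg) (delta y)‖ := by
  have hw : colNorm (polyWeight 1) (kcomp (absEnt P) (absEnt P)) ≠ ∞ :=
    ne_top_of_le_ne_top (ENNReal.mul_ne_top (hP.colNorm_ne_top 1) (hP.colNorm_ne_top 1))
      (colNorm_kcomp_le (polyWeight_add_le 1) _ _)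
  have hper : ∀ p x y, absEnt P (trans p x) (trans p y) = absEnt P x y := fun p x y => by
    rw [absEnt, hP.periodic]; rfl
  have hper' : ∀ p x y, kcomp (absEnt P) (absEnt P) (trans p x) (trans p y) =
      kcomp (absEnt P) (absEnt P) x y := fun p x y => by
    rw [kcomp, ← (trans p).tsum_eq]
    exact tsum_congr fun u => by rw [hper, hper]
  have h1 := tsum_stripe_ne_top hper (hP.colNorm_ne_top 1) hl s
  have h2 := tsum_stripe_ne_top hper' hw hl s
  refine summable_of_tsum_enorm_ne_top (ne_top_of_le_ne_top (ENNReal.add_ne_top.2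
    ⟨ENNReal.mul_ne_top (enorm_ne_top (x := P * diagOp f hf * P)) h1,
      ENNReal.mul_ne_top (enorm_ne_top (x := P)) h2⟩) ?_)
  rw [← ENNReal.tsum_mul_left, ← ENNReal.tsum_mul_left, ← ENNReal.tsum_add]
  refine ENNReal.tsum_le_tsum fun y => ?_
  rw [enorm_mul, enorm_norm]
  have e : ‖(s : Set ℤ).indicator (fun _ => (1 : ℝ)) (y.1 0)‖ₑ =
      (s : Set ℤ).indicator (fun _ => (1 : ℝ≥0∞)) (y.1 0) := by
    by_cases h : y.1 0 ∈ s <;> simp [h]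
  rw [e]
  refine (mul_le_mul_right (hP.enorm_kuboBounded_delta_le hf hg y) _).trans (le_of_eq ?_)
  ring

end Conductance

/-! ### The operators of the theorem in terms of multiplication operators. -/

/-- The spin operator is bounded and everywhere defined, so the natural domain of the product is
exactly the maximal domain of the product function. -/
theorem prod_latOp_Sz (f : Lattice → ℝ) :
    prod (latOp N f) (Sz N) = mulOp fun x => f x.1 * spin x := by
  have hs : ∀ x : Site N, |spin x| ≤ 1 := fun x => by rw [abs_spin]; norm_num
  refine (LinearPMap.eq_of_le_of_domain_eq (LinearPMap.le_of_le_graph ?_) ?_).symm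
  · rintro ⟨φ, ψ⟩ h
    rw [mem_mulOp_graph] at h
    refine prod_graph (ψ := diagOp spin hs φ) (diagOp_graph hs φ) (mem_mulOp_graph.2 fun x => ?_)
    rw [h, diagOp_apply]
    push_cast
    ring
  · refine le_antisymm (fun φ hφ => ?_) (fun φ hφ => ?_)
    · obtain ⟨ψ, hψ⟩ := LinearPMap.mem_domain_iff.1 hφ
      rw [mem_mulOp_graph] at hψ
      refine LinearPMap.mem_domain_of_mem_graph (y := ψ) (prod_graph (ψ := diagOp spin hs φ)
        (diagOp_graph hs φ) (mem_mulOp_graph.2 fun x => ?_))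
      rw [hψ, diagOp_apply]
      push_cast
      ring
    · obtain ⟨y, hy, rfl⟩ := hφ
      refine LinearPMap.mem_domain_of_mem_graph (y := latOp N f ⟨Sz N y, hy⟩)
        (mem_mulOp_graph.2 fun x => ?_)
      change (f x.1 : ℂ) * ((spin x : ℂ) * y.1 x) = _
      push_cast
      rw [mul_assoc]
      rfl

theorem conductanceOp_eq (P : Hdisc N →L[ℂ] Hdisc N) (f g : Lattice → ℝ) :
    conductanceOp P f g = kubo P (mulOp fun x => f x.1 * spin x) (mulOp fun x => g x.1) := by
  rw [conductanceOp, prod_latOp_Sz]; rfl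

theorem conductivityOp_eq (P : Hdisc N →L[ℂ] Hdisc N) :
    conductivityOp P =
      kubo P (mulOp fun x => (x.1 0 : ℝ) * spin x) (mulOp fun x => (x.1 1 : ℝ)) := by
  rw [conductivityOp, X, prod_latOp_Sz]; rfl

theorem torqueOp_eq (P : Hdisc N →L[ℂ] Hdisc N) :
    torqueOp P = kubo P (mulOp spin) (mulOp fun x => (x.1 1 : ℝ)) := rfl

/-! ### Twisted periodicity of the conductivity. -/

section Kubo

variable {P : Hdisc N →L[ℂ] Hdisc N}

theorem polyBdd_coord_mul_spin (j : Fin 2) : PolyBdd fun x : Site N => (x.1 j : ℝ) * spin x :=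
  (PolyBdd.coord j).mul .spin

/-- The conductivity per unit cell. -/
def cellConductivity (P : Hdisc N →L[ℂ] Hdisc N) : ℂ :=
  Complex.I * cellTrace P fun _ => wedge (fun x => (x.1 0 : ℝ) * spin x) fun x => (x.1 1 : ℝ)

theorem IsLocalProj.pathSum_wedge_add_mul (hP : IsLocalProj P) {f s g : Site N → ℝ}
    (hf : PolyBdd f) (hs : PolyBdd s) (hg : PolyBdd g) (c : ℝ) (x y : Site N) :
    pathSum P (wedge (fun u => (f u + c) * s u) g) x y =
      pathSum P (wedge (fun u => f u * s u) g) x y + c * pathSum P (wedge s g) x y := by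
  have e : wedge (fun u => (f u + c) * s u) g =
      fun u v => wedge (fun u => f u * s u) g u v - (-c) * wedge s g u v := by
    funext u v; simp only [wedge]; ring
  rw [e, hP.pathSum_sub ((hf.mul hs).wedge hg) ((hs.wedge hg).const_mul _), pathSum_const_mul]
  push_cast
  ring

/-- The shift of the second coordinate is an irrelevant constant. The shift of the first one is
multiplied by the spin, which is not constant, and leaves the torque term. -/
theorem IsLocalProj.pathSum_conductivity_trans (hP : IsLocalProj P) (p : Lattice) (x y : Site N) :
    pathSum P (wedge (fun u => (u.1 0 : ℝ) * spin u) fun u => (u.1 1 : ℝ))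
        (trans p x) (trans p y) =
      pathSum P (wedge (fun u => (u.1 0 : ℝ) * spin u) fun u => (u.1 1 : ℝ)) x y +
        (p 0 : ℂ) * pathSum P (wedge spin fun u => (u.1 1 : ℝ)) x y := by
  have h0 : PolyBdd fun u : Site N => (u.1 0 : ℝ) := .coord 0
  have h1 : PolyBdd fun u : Site N => (u.1 1 : ℝ) := .coord 1
  have hF : PolyBdd fun u : Site N => ((u.1 0 : ℝ) + p 0) * spin u := by
    simpa using (h0.trans p).mul .spin
  have e : (fun u v : Site N => wedge (fun u => (u.1 0 : ℝ) * spin u) (fun u => (u.1 1 : ℝ))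
      (trans p u) (trans p v)) =
      wedge (fun u => ((u.1 0 : ℝ) + p 0) * spin u) fun u => (u.1 1 : ℝ) - (-(p 1 : ℝ)) := by
    funext u v
    simp only [wedge, trans_fst, spin_trans, Pi.add_apply]
    push_cast
    ring
  rw [hP.pathSum_trans, e, hP.pathSum_wedge_sub_const hF h1, hP.pathSum_wedge_add_mul h0 .spin h1]
  norm_cast

theorem IsLocalProj.kernel_kubo (hP : IsLocalProj P) {f g : Site N → ℝ} (hf : PolyBdd f)
    (hg : PolyBdd g) (m n : Lattice) (i k : Internal N) :
    kernel (kubo P (mulOp f) (mulOp g)) m n i k =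
      Complex.I * pathSum P (wedge f g) (m, i) (n, k) := by
  rw [kernel_apply_of_graph (hP.kuboVec_graph hf hg (n, k)), hP.kuboVec_apply hf hg]

theorem IsLocalProj.kernel_conductivityOp (hP : IsLocalProj P) (m n p : Lattice) :
    kernel (conductivityOp P) m n =
      kernel (conductivityOp P) (m - p) (n - p) +
        (p 0 : ℂ) • kernel (torqueOp P) (m - p) (n - p) := by
  have h1 : PolyBdd fun u : Site N => (u.1 1 : ℝ) := .coord 1
  ext i k
  rw [Matrix.add_apply, Matrix.smul_apply, conductivityOp_eq, torqueOp_eq,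
    hP.kernel_kubo (polyBdd_coord_mul_spin 0) h1, hP.kernel_kubo (polyBdd_coord_mul_spin 0) h1,
    hP.kernel_kubo .spin h1, smul_eq_mul]
  have h := hP.pathSum_conductivity_trans p (m - p, i) (n - p, k)
  rw [trans_apply, trans_apply, sub_add_cancel, sub_add_cancel] at h
  rw [h]
  ring

/-! ### The conductance -/

/-- The constant contributes a multiple of the torque, which vanishes only after summation over the
cell. -/
theorem IsLocalProj.cellTrace_wedge_sub_const_mul_spin (hP : IsLocalProj P) {f : Site N → ℝ}
    (hf : PolyBdd f) (c : ℝ) (j : Fin 2) :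
    cellTrace P (fun _ => wedge (fun u => (f u - c) * spin u) fun v => (v.1 j : ℝ)) =
      cellTrace P (fun _ => wedge (fun u => f u * spin u) fun v => (v.1 j : ℝ)) := by
  have h := hP.cellTrace_torque j
  simp only [cellTrace] at h ⊢
  simp only [sub_eq_add_neg, hP.pathSum_wedge_add_mul hf .spin (.coord j)]
  rw [Finset.sum_add_distrib, ← Finset.mul_sum, h, mul_zero, add_zero]

section Steps

variable {l l' : ℤ → ℝ} {a b a' b' : ℤ}

theorem IsLocalProj.hasSum_cellTrace_snd (hP : IsLocalProj P) (hl : IsStep l a b) {f : Site N → ℝ}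
    (hf : PolyBdd f) (j : Fin 2) :
    HasSum (fun n => cellTrace P fun _ => wedge f fun v => l (v.1 j + n) - l n)
      (cellTrace P fun _ => wedge f fun v => (v.1 j : ℝ)) := by
  refine hasSum_sum fun i _ => ?_
  simpa using hP.hasSum_pathSum_wedge hl j hf (PolyBdd.const 1) (0, i) (0, i)

theorem IsLocalProj.hasSum_cellTrace_fst (hP : IsLocalProj P) (hl : IsStep l a b) {g : Site N → ℝ}
    (hg : PolyBdd g) (j : Fin 2) :
    HasSum (fun n => cellTrace P fun _ => wedge (fun v => (l (v.1 j + n) - l n) * spin v) g)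
      (cellTrace P fun _ => wedge (fun v => (v.1 j : ℝ) * spin v) g) := by
  refine hasSum_sum fun i _ => ?_
  rw [pathSum_wedge_swap]
  refine (hP.hasSum_pathSum_wedge hl j hg .spin (0, i) (0, i)).neg.congr_fun fun n => ?_
  exact pathSum_wedge_swap _ _ _ _

theorem IsLocalProj.sum_pathSum_diag (hP : IsLocalProj P) (hl : IsStep l a b)
    (hl' : IsStep l' a' b') (n : Lattice) :
    ∑ i, pathSum P (wedge (fun x => l (x.1 0) * spin x) fun x => l' (x.1 1)) (n, i) (n, i) =
      cellTrace P fun _ => wedge (fun x => l (x.1 0 + n 0) * spin x)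
        fun x => l' (x.1 1 + n 1) - l' (n 1) := by
  refine Finset.sum_congr rfl fun i _ => ?_
  have h := hP.pathSum_trans (wedge (fun x => l (x.1 0) * spin x) fun x => l' (x.1 1)) n
    (0, i) (0, i)
  rw [trans_apply n 0, zero_add] at h
  rw [h, hP.pathSum_wedge_sub_const ((hl.polyBdd 0 (n 0)).mul .spin) (hl'.polyBdd 1 (n 1))]
  rfl

/-- Absolute summability lets the sum over `n₁` be taken first, which turns `l'` into the
coordinate. Only then does the vanishing torque allow `l m` to be subtracted. -/
theorem IsLocalProj.tsum_stripe (hP : IsLocalProj P) (hl : IsStep l a b) (hl' : IsStep l' a' b')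
    (s : Finset ℤ)
    (hs : Summable fun y : Site N => (s : Set ℤ).indicator (fun _ => (1 : ℂ)) (y.1 0) *
      (Complex.I * pathSum P (wedge (fun x => l (x.1 0) * spin x) fun x => l' (x.1 1)) y y)) :
    ∑' y : Site N, (s : Set ℤ).indicator (fun _ => (1 : ℂ)) (y.1 0) *
      (Complex.I * pathSum P (wedge (fun x => l (x.1 0) * spin x) fun x => l' (x.1 1)) y y) =
    ∑ m ∈ s, Complex.I * cellTrace P fun _ =>
      wedge (fun x => (l (x.1 0 + m) - l m) * spin x) fun x => (x.1 1 : ℝ) := by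
  have e : ∀ n : Lattice, ∑' i : Internal N, (s : Set ℤ).indicator (fun _ => (1 : ℂ)) (n 0) *
      (Complex.I * pathSum P (wedge (fun x => l (x.1 0) * spin x) fun x => l' (x.1 1))
        (n, i) (n, i)) =
      (s : Set ℤ).indicator (fun _ => (1 : ℂ)) (n 0) * (Complex.I * cellTrace P fun _ =>
        wedge (fun x => l (x.1 0 + n 0) * spin x) fun x => l' (x.1 1 + n 1) - l' (n 1)) := by
    intro n
    rw [tsum_fintype, ← Finset.mul_sum, ← Finset.mul_sum, hP.sum_pathSum_diag hl hl']
  have hs' := hs.prod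
  simp only [e] at hs'
  rw [hs.tsum_prod]
  simp only [e]
  rw [← (finTwoArrowEquiv ℤ).symm.summable_iff] at hs'
  rw [← (finTwoArrowEquiv ℤ).symm.tsum_eq]
  refine hs'.tsum_prod.trans ?_
  simp only [Function.comp_apply, finTwoArrowEquiv_symm_apply, Matrix.cons_val_zero,
    Matrix.cons_val_one]
  rw [tsum_eq_sum (s := s) fun m hm => by simp [hm]]
  refine Finset.sum_congr rfl fun m hm => ?_
  rw [tsum_mul_left, tsum_mul_left, Set.indicator_of_mem (by simpa using hm), one_mul,
    hP.cellTrace_wedge_sub_const_mul_spin (hl.polyBdd 0 m),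
    (hP.hasSum_cellTrace_snd hl' ((hl.polyBdd 0 m).mul .spin) 1).tsum_eq]

/-- For odd `L = 2k + 1` the window is symmetric and has exactly `L` integer points. -/
theorem abs_le_half_iff (k : ℕ) (n : ℤ) :
    |(n : ℝ)| ≤ ((2 * k + 1 : ℕ) : ℝ) / 2 ↔ n ∈ Finset.Icc (-(k : ℤ)) k := by
  rw [Finset.mem_Icc, ← abs_le, le_div_iff₀ two_pos]
  have h : |(n : ℝ)| * 2 ≤ ((2 * k + 1 : ℕ) : ℝ) ↔ |n| * 2 ≤ 2 * (k : ℤ) + 1 := by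
    rw [← Int.cast_abs]
    exact_mod_cast Iff.rfl
  rw [h]
  omega

theorem IsLocalProj.hasTrace_stripe (hP : IsLocalProj P) (hl : IsStep l a b)
    (hl' : IsStep l' a' b') (k : ℕ) :
    HasTrace (prod (chiDir N 0 (2 * k + 1)) (prod
      (kubo P (mulOp fun x => l (x.1 0) * spin x) (mulOp fun x => l' (x.1 1)))
      (chiDir N 0 (2 * k + 1))))
      (∑ m ∈ Finset.Icc (-(k : ℤ)) k, Complex.I * cellTrace P fun _ =>
        wedge (fun x => (l (x.1 0 + m) - l m) * spin x) fun x => (x.1 1 : ℝ)) := by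
  set s := Finset.Icc (-(k : ℤ)) k
  set c : Site N → ℝ := fun x => (s : Set ℤ).indicator (fun _ => (1 : ℝ)) (x.1 0) with hc
  have hchi : chiDir N 0 (2 * k + 1) = mulOp c := by
    rw [chiDir, latOp]
    congr 1
    funext x
    rw [hc]
    simp only [Set.indicator_apply, Set.mem_ofPred_eq, Finset.mem_coe, abs_le_half_iff, s]
  have hc1 : ∀ x, |c x| ≤ 1 := fun x => by
    by_cases h : x.1 0 ∈ s <;> simp [hc, h]
  have hcc : ∀ x, (c x : ℂ) * c x = c x := fun x => by
    by_cases h : x.1 0 ∈ s <;> simp [hc, h]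
  have hcC : ∀ x : Site N, (c x : ℂ) = (s : Set ℤ).indicator (fun _ => (1 : ℂ)) (x.1 0) :=
    fun x => by by_cases h : x.1 0 ∈ s <;> simp [hc, h]
  have hf : ∀ x : Site N, |l (x.1 0) * spin x| ≤ 1 := fun x => by
    rw [abs_mul, abs_spin, abs_of_nonneg (hl.nonneg _)]
    linarith [hl.le_one (x.1 0)]
  have hg : ∀ x : Site N, |l' (x.1 1)| ≤ 1 := fun x => by
    rw [abs_of_nonneg (hl'.nonneg _)]
    exact hl'.le_one _
  set G := kuboBounded P (diagOp _ hf) (diagOp _ hg)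
  set D := diagOp c hc1 with hD
  have hent : ∀ y, ent (D * G * D) y y = (c y : ℂ) * (Complex.I *
      pathSum P (wedge (fun x => l (x.1 0) * spin x) fun x => l' (x.1 1)) y y) := by
    intro y
    rw [← hP.ent_kuboBounded hf hg, ent_eq, ent_eq, mul_apply_eq_comp, mul_apply_eq_comp, hD,
      diagOp_delta, diagOp_apply, map_smul, lp.coeFn_smul, Pi.smul_apply, smul_eq_mul,
      ← mul_assoc, hcc]
  have hsum : Summable fun y => ‖(D * G * D) (delta y)‖ := by
    refine Summable.of_nonneg_of_le (fun _ => norm_nonneg _) (fun y => ?_)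
      (hP.summable_stripe hf hl' hg s)
    rw [mul_apply_eq_comp, mul_apply_eq_comp]
    refine (norm_diagOp_apply_le hc1 _).trans ?_
    rw [hD, diagOp_delta, map_smul, norm_smul, Complex.norm_real]
    gcongr
    rw [Real.norm_of_nonneg]
    exact Set.indicator_nonneg (fun _ _ => zero_le_one) _
  have ht := hasTrace_of_summable (A := prod (chiDir N 0 (2 * k + 1)) (prod
      (kubo P (mulOp fun x => l (x.1 0) * spin x) (mulOp fun x => l' (x.1 1)))
      (chiDir N 0 (2 * k + 1)))) (B := D * G * D) (fun φ => by
    rw [hchi]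
    exact prod_graph (prod_graph (diagOp_graph hc1 φ) (hP.kuboBounded_graph hf hg _))
      (diagOp_graph hc1 _)) hsum
  have hs2 : Summable fun y => ent (D * G * D) y y := by
    refine Summable.of_norm_bounded hsum fun y => ?_
    simpa [ent, norm_delta] using norm_inner_le_norm (𝕜 := ℂ) (delta y) ((D * G * D) (delta y))
  simp only [hent, hcC] at ht hs2
  rwa [hP.tsum_stripe hl hl' s hs2] at ht

/-- The windows `[-k, k]` exhaust `ℤ`, so the stripe traces converge to the unconditional sum over
translates. -/
theorem IsLocalProj.hasDirPVTrace (hP : IsLocalProj P) (hl : IsStep l a b)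
    (hl' : IsStep l' a' b') :
    HasDirPVTrace 0 (kubo P (mulOp fun x => l (x.1 0) * spin x) (mulOp fun x => l' (x.1 1)))
      (cellConductivity P) := by
  refine ⟨_, hP.hasTrace_stripe hl hl', ?_⟩
  exact ((hP.hasSum_cellTrace_fst hl (.coord 1) 0).mul_left Complex.I).comp Finset.tendsto_Icc_neg

end Steps

/-! ### The conductivity -/

/-- The diagonal of `Σ` in the cell `n` differs from that at the origin by `n 0` times the torque,
whose cell trace is zero. All `(2k + 1)²` cells therefore contribute equally. -/
theorem IsLocalProj.hasTrace_box (hP : IsLocalProj P) (k : ℕ) :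
    HasTrace (prod (chi N (2 * k + 1)) (prod (conductivityOp P) (chi N (2 * k + 1))))
      (((2 * k + 1 : ℕ) : ℂ) ^ 2 * cellConductivity P) := by
  classical
  have h0 : PolyBdd fun x : Site N => (x.1 0 : ℝ) * spin x := polyBdd_coord_mul_spin 0
  have h1 : PolyBdd fun x : Site N => (x.1 1 : ℝ) := .coord 1
  set box : Finset Lattice := Fintype.piFinset fun _ => Finset.Icc (-(k : ℤ)) k with hbox
  set F : Finset (Site N) := box ×ˢ Finset.univ with hF
  have hmem : ∀ x : Site N, x ∈ F ↔ ∀ j, |(x.1 j : ℝ)| ≤ ((2 * k + 1 : ℕ) : ℝ) / 2 := fun x => by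
    simp only [hF, hbox, Finset.mem_product, Finset.mem_univ, and_true, Fintype.mem_piFinset,
      abs_le_half_iff]
  set c : Site N → ℝ := fun x => if x ∈ F then 1 else 0 with hc
  have hchi : chi N (2 * k + 1) = mulOp c := by
    rw [chi, latOp]
    congr 1
    funext x
    rw [hc]
    simp only [Set.indicator_apply, Set.mem_ofPred_eq, hmem]
  have hc1 : ∀ x, |c x| ≤ 1 := fun x => by by_cases h : x ∈ F <;> simp [hc, h]
  set V : Site N → Hdisc N :=
    kuboVec P (fun x => (x.1 0 : ℝ) * spin x) (fun x => (x.1 1 : ℝ)) with hV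
  -- The compression of the possibly unbounded `Σ` to a finite box, written as a finite-rank bounded
  -- operator.
  set B : Hdisc N →L[ℂ] Hdisc N :=
    ∑ y ∈ F, (innerSL ℂ (delta y)).smulRight (diagOp c hc1 (V y)) with hB
  have hBapp : ∀ φ, B φ = diagOp c hc1 (∑ y ∈ F, φ y • V y) := fun φ => by
    simp only [hB, _root_.sum_apply, ContinuousLinearMap.smulRight_apply,
      innerSL_apply_apply, inner_delta, map_sum, map_smul]
  have hchiapp : ∀ φ, diagOp c hc1 φ = ∑ y ∈ F, φ y • (delta y : Hdisc N) := fun φ => by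
    apply lp.ext
    funext x
    rw [diagOp_apply, lp.coeFn_sum, Finset.sum_apply]
    simp only [lp.coeFn_smul, Pi.smul_apply, delta_apply, smul_eq_mul, mul_ite, mul_one, mul_zero,
      Finset.sum_ite_eq, hc]
    split_ifs <;> simp
  have hgraph : ∀ φ, (φ, B φ) ∈
      (prod (chi N (2 * k + 1)) (prod (conductivityOp P) (chi N (2 * k + 1)))).graph := by
    intro φ
    rw [hchi, hBapp]
    refine prod_graph (prod_graph (ψ := diagOp c hc1 φ) (diagOp_graph hc1 φ)
      (χ := ∑ y ∈ F, φ y • V y) ?_) (diagOp_graph hc1 _)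
    rw [hchiapp, conductivityOp_eq]
    have := Submodule.sum_mem (kubo P (mulOp fun x => (x.1 0 : ℝ) * spin x)
      (mulOp fun x => (x.1 1 : ℝ))).graph (t := F) (f := fun y => φ y • (delta y, V y))
      fun y _ => Submodule.smul_mem _ _ (hP.kuboVec_graph h0 h1 y)
    have e : ∑ y ∈ F, φ y • ((delta y : Hdisc N), V y) =
        (∑ y ∈ F, φ y • (delta y : Hdisc N), ∑ y ∈ F, φ y • V y) :=
      Prod.ext (by simp [Prod.fst_sum]) (by simp [Prod.snd_sum])
    rwa [e] at this
  have hBdelta : ∀ x, B (delta x) = if x ∈ F then diagOp c hc1 (V x) else 0 := fun x => by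
    rw [hBapp]
    simp only [delta_apply, ite_smul, one_smul, zero_smul, Finset.sum_ite_eq']
    split_ifs <;> simp
  have hsum : Summable fun x => ‖B (delta x)‖ :=
    summable_of_ne_finset_zero (s := F) fun x hx => by simp [hBdelta, hx]
  have ht := hasTrace_of_summable hgraph hsum
  rw [tsum_eq_sum (s := F) fun x hx => by simp [ent_eq, hBdelta, hx]] at ht
  convert ht using 1
  have hdiag : ∀ n ∈ box, ∑ i, ent B (n, i) (n, i) = cellConductivity P := by
    intro n hn
    have hent : ∀ i : Internal N, ent B (n, i) (n, i) = Complex.I *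
        (pathSum P (wedge (fun u => (u.1 0 : ℝ) * spin u) fun u => (u.1 1 : ℝ)) (0, i) (0, i) +
          (n 0 : ℂ) * pathSum P (wedge spin fun u => (u.1 1 : ℝ)) (0, i) (0, i)) := by
      intro i
      have hmemF : (n, i) ∈ F := Finset.mem_product.2 ⟨hn, Finset.mem_univ _⟩
      have h := hP.pathSum_conductivity_trans n (0, i) (0, i)
      rw [trans_apply n 0, zero_add] at h
      rw [ent_eq, hBdelta, if_pos hmemF, diagOp_apply, hV, hP.kuboVec_apply h0 h1, h]
      simp [hc, hmemF]
    have ht := hP.cellTrace_torque 1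
    rw [cellTrace] at ht
    simp only [hent]
    rw [← Finset.mul_sum, Finset.sum_add_distrib, ← Finset.mul_sum, ht, mul_zero, add_zero]
    rfl
  have hcard : box.card = (2 * k + 1) ^ 2 := by
    rw [hbox, Fintype.card_piFinset]
    simp only [Int.card_Icc, Finset.prod_const, Finset.card_univ, Fintype.card_fin]
    congr 1
    omega
  rw [hF, Finset.sum_product, Finset.sum_congr rfl hdiag, Finset.sum_const, hcard, nsmul_eq_mul,
    Nat.cast_pow]

/-- The normalised box traces do not depend on `L`, so the limit is that of a constant sequence. -/
theorem IsLocalProj.hasTUV (hP : IsLocalProj P) :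
    HasTUV (conductivityOp P) (cellConductivity P) := by
  refine ⟨_, hP.hasTrace_box, tendsto_const_nhds.congr fun k => ?_⟩
  have h : ((2 * k + 1 : ℕ) : ℂ) ≠ 0 := Nat.cast_ne_zero.2 (by omega)
  field_simp

end Kubo

end SpinTransport

end

theorem theorem2p7 (N : ℕ) (H : SpinTransport.Hdisc N →L[ℂ] SpinTransport.Hdisc N)
    (hsa : IsSelfAdjoint H) (hns : SpinTransport.IsNearSighted H)
    (hper : SpinTransport.IsPeriodic H) (a b μ : ℝ) (hgap : SpinTransport.HasSpectralGap H a b)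
    (hμ : μ ∈ Set.Ioo a b) (P : SpinTransport.Hdisc N →L[ℂ] SpinTransport.Hdisc N)
    (hP : P = SpinTransport.fermi H μ) :
    -- (1) if the conductance is finite for one `Λ₁`, it is finite and the same for every `Λ₁'`
    (∀ Λ₂, SpinTransport.IsSwitch 1 Λ₂ → ∀ Λ₁, SpinTransport.IsSwitch 0 Λ₁ → ∀ g : ℂ,
      SpinTransport.HasDirPVTrace 0 (SpinTransport.conductanceOp P Λ₁ Λ₂) g →
      ∀ Λ₁', SpinTransport.IsSwitch 0 Λ₁' →
        SpinTransport.HasDirPVTrace 0 (SpinTransport.conductanceOp P Λ₁' Λ₂) g) ∧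
    -- (2) the kernels of `Σ` and `𝒯` are well defined and satisfy the twisted periodicity relation
    (∀ x : SpinTransport.Site N,
      SpinTransport.delta x ∈ (SpinTransport.conductivityOp P).domain ∧
      SpinTransport.delta x ∈ (SpinTransport.torqueOp P).domain) ∧
    (∀ m n p : SpinTransport.Lattice,
      SpinTransport.kernel (SpinTransport.conductivityOp P) m n =
        SpinTransport.kernel (SpinTransport.conductivityOp P) (m - p) (n - p) +
          (p 0 : ℂ) • SpinTransport.kernel (SpinTransport.torqueOp P) (m - p) (n - p)) ∧
    -- `σ` is the trace per unit volume of `Σ`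
    ∃ σ : ℂ, SpinTransport.HasTUV (SpinTransport.conductivityOp P) σ ∧
      SpinTransport.HasTrace (SpinTransport.prod (SpinTransport.chi N 1)
        (SpinTransport.prod (SpinTransport.conductivityOp P) (SpinTransport.chi N 1))) σ ∧
      -- (3) the conductance is finite and equal to `σ` for all switch functions
      ∀ Λ₁ Λ₂, SpinTransport.IsSwitch 0 Λ₁ → SpinTransport.IsSwitch 1 Λ₂ →
        SpinTransport.HasDirPVTrace 0 (SpinTransport.conductanceOp P Λ₁ Λ₂) σ := by
  have hloc : SpinTransport.IsLocalProj P :=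
    hP ▸ SpinTransport.isLocalProj_fermi hsa hns hper hgap hμ
  have hmain : ∀ Λ₁ Λ₂, SpinTransport.IsSwitch 0 Λ₁ → SpinTransport.IsSwitch 1 Λ₂ →
      SpinTransport.HasDirPVTrace 0 (SpinTransport.conductanceOp P Λ₁ Λ₂)
        (SpinTransport.cellConductivity P) := by
    intro Λ₁ Λ₂ h₁ h₂
    obtain ⟨l, c, d, hl, e⟩ := h₁.exists_isStep
    obtain ⟨l', c', d', hl', e'⟩ := h₂.exists_isStep
    rw [SpinTransport.conductanceOp_eq]
    simp only [e, e']
    exact hloc.hasDirPVTrace hl hl'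
  have hX : SpinTransport.PolyBdd fun x : SpinTransport.Site N => (x.1 1 : ℝ) := .coord 1
  refine ⟨fun Λ₂ h₂ Λ₁ h₁ g hg Λ₁' h₁' => ?_, fun x => ⟨?_, ?_⟩,
    hloc.kernel_conductivityOp, SpinTransport.cellConductivity P, hloc.hasTUV, ?_, hmain⟩
  -- The assumed value `g` has to be the cell conductivity, by uniqueness of the principal value
  -- trace.
  · rw [hg.unique (hmain Λ₁ Λ₂ h₁ h₂)]
    exact hmain Λ₁' Λ₂ h₁' h₂
  · rw [SpinTransport.conductivityOp_eq]
    exact LinearPMap.mem_domain_of_mem_graph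
      (hloc.kuboVec_graph (SpinTransport.polyBdd_coord_mul_spin 0) hX x)
  · rw [SpinTransport.torqueOp_eq]
    exact LinearPMap.mem_domain_of_mem_graph (hloc.kuboVec_graph .spin hX x)
  -- The case `L = 1`, in which the box is the single cell at the origin.
  · simpa using hloc.hasTrace_box 0
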